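/- **Setting.** All spaces are over $\mathbb C$; inner products are linear in the first argument. Let $X,Y$ be separable Hilbert spaces, $X$ continuously and densely embedded in $Y$. Let $X^*$ be the space of bounded conjugate-linear functionals on $X$, with $Y\subset X^*$ through $\langle v,w\rangle_X:=(v,w)_Y$. Let $\mathcal A,\mathcal A^*:X\to Y$ be bounded linear operators and $\pi/2<\omega_0<\pi$, $c_0,c_1,\mathcal M_0>0$ be such that, with $\Sigma_{\omega_0}=\{re^{i\gamma}:r>0,\ |\gamma|<\omega_0\}$ and $\mathcal A,\mathcal A^*$ regarded as operators in $Y$ with domain $X$: $\rho(\mathcal A)$ and $\rho(\mathcal A^*)$ contain $\Sigma_{\omega_0}\cup\{0\}$; $\|(z-\mathcal A)^{-1}\|_{\mathcal L(Y)}$ and $\|(z-\mathcal A^*)^{-1}\|_{\mathcal L(Y)}$ are at most $\mathcal M_0/(1+|z|)$ for $z\in\Sigma_{\omega_0}$; $(\mathcal Av,w)_Y=(v,\mathcal A^*w)_Y$ for $v,w\in X$; and $c_0\|v\|_X\le\|\mathcal Av\|_Y\le c_1\|v\|_X$, $c_0\|v\|_X\le\|\mathcal A^*v\|_Y\le c_1\|v\|_X$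 for $v\in X$. Extend $\mathcal A,\mathcal A^*$ to operators $Y\to X^*$ by $\langle\mathcal Av,w\rangle_X:=(v,\mathcal A^*w)_Y$ and $\langle\mathcal A^*v,w\rangle_X:=(v,\mathcal Aw)_Y$. Let $0<\alpha\le1$, $0<T<\infty$, $J>1$ an integer, $\tau=T/J$, $t_j=j\tau$, and let $W_\tau(E)$ be the space of $E$-valued functions on $(0,T)$ that are constant on each $(t_{j-1},t_j)$, $1\le j\le J$ (functions equal a.e. being identified). For $\alpha<1$ let $\mathrm D_{0+}^{\alpha}v$ and $\mathrm D_{T-}^{\alpha}v$ be the Riemann–Liouville derivatives, that is, $\mathrm D$ and $-\mathrm D$ (the distributional derivative on $(0,T)$ and its negative) applied to $\frac1{\Gamma(1-\alpha)}\int_0^t(t-s)^{-\alpha}v(s)\,ds$ and $\frac1{\Gamma(1-\alpha)}\int_t^T(s-t)^{-\alpha}v(s)\,ds$, respectively. For $g\in L^1(0,T;X^*)$ the functions $\mathcal S_{\alpha,\tau}g=W\in W_\tau(Y)$ and $\mathcal S^*_{\alpha,\tau}g=\widetilde W\in W_\tau(Y)$ are defined by requiring, for all $V\in W_\tau(X)$: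 if $\alpha<1$, $$\int_0^T\langle(\mathrm D_{0+}^\alpha-\mathcal A)W,V\rangle_X\,dt=\int_0^T\langle g,V\rangle_X\,dt,\qquad \int_0^T\langle(\mathrm D_{T-}^\alpha-\mathcal A^*)\widetilde W,V\rangle_X\,dt=\int_0^T\langle g,V\rangle_X\,dt;$$ if $\alpha=1$, $$(W(0+),V(0+))_Y+\sum_{j=1}^{J-1}(W(t_j+)-W(t_j-),V(t_j+))_Y-\int_0^T\langle\mathcal AW,V\rangle_X\,dt=\int_0^T\langle g,V\rangle_X\,dt,$$ $$(\widetilde W(T-),V(T-))_Y+\sum_{j=1}^{J-1}(\widetilde W(t_j-)-\widetilde W(t_j+),V(t_j-))_Y-\int_0^T\langle\mathcal A^*\widetilde W,V\rangle_X\,dt=\int_0^T\langle g,V\rangle_X\,dt.$$ Let $Z$ be a Hilbert space, $0<\theta_0\le1$, and $\mathcal R_{\theta_0}:Z\to[X^*,Y]_{\theta_0}$ a bounded linear operator (complex interpolation; $\theta=0$ corresponds to $X^*$ and $\theta=1$ to $Y$). Define $\mathcal R_{\theta_0}^*v\in Z$ by $(\mathcal R_{\theta_0}^*v,w)_Z=\overline{\langle\mathcal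 R_{\theta_0}w,v\rangle}$ for all $w\in Z$; for $v\in X$ the pairing is that of $X^*$ and $X$. Let $U_{\rm ad}\subset L^\infty(0,T;Z)$ be a nonempty, convex, bounded and closed subset of $L^2(0,T;Z)$, $y_d\in Y$, $\nu>0$, and $$J_{\alpha,\tau}(U):=\tfrac12\|(\mathcal S_{\alpha,\tau}\mathcal R_{\theta_0}U)(T-)-y_d\|_Y^2+\tfrac\nu2\|U\|_{L^2(0,T;Z)}^2 .$$ **Theorem.** For every $g\in L^1(0,T;X^*)$ the functions $\mathcal S_{\alpha,\tau}g$ and $\mathcal S_{\alpha,\tau}^*g$ exist and are unique; $\mathcal R_{\theta_0}u\in L^1(0,T;X^*)$ for every $u\in L^2(0,T;Z)$; and $\mathcal R_{\theta_0}^*v$ exists for every $v\in X$. The problem $\min_{U\in U_{\rm ad}}J_{\alpha,\tau}(U)$ has a unique solution $U\in U_{\rm ad}$. With $$\mathbf Y:=\mathcal S_{\alpha,\tau}\mathcal R_{\theta_0}U,\qquad P:=\mathcal S_{\alpha,\tau}^*\big((\mathbf Y(T-)-y_d)\widehat\delta_T\big),\qquad \widehat\delta_T(t):=\begin{cases}0,&0<t<T-\tau,\\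 \tau^{-1},&T-\tau<t<T,\end{cases}$$ one has $P\in W_\tau(X)$ and $$\operatorname{Re}\int_0^T\big(\mathcal R_{\theta_0}^*P(t)+\nu U(t),\,V(t)-U(t)\big)_Z\,dt\ \ge\ 0\qquad\text{for all }V\in U_{\rm ad}.$$ -/

import Mathlib

open MeasureTheory Set Filter Topology

namespace FracControl

noncomputable section

/-! ### Complex interpolation -/

section Interpolation

variable {E₀ E₁ V : Type*}
  [NormedAddCommGroup E₀] [NormedSpace ℂ E₀]
  [NormedAddCommGroup E₁] [NormedSpace ℂ E₁]
  [NormedAddCommGroup V] [NormedSpace ℂ V]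

/-- The Calderon class of a couple `(E₀, E₁)`, both continuously embedded (by `i₀`, `i₁`) into `V`,
where `V` is the larger of the two spaces, i.e. `V = E₀ + E₁`: functions that are continuous and
bounded on the closed strip `0 ≤ Re z ≤ 1` with values in `V`, holomorphic in its interior, and
whose traces on `Re z = 0` and `Re z = 1` are bounded continuous functions `f₀`, `f₁` with values
in `E₀` and in `E₁`. -/
structure IsCalderon (i₀ : E₀ →L[ℂ] V) (i₁ : E₁ →L[ℂ] V) (f : ℂ → V)
    (f₀ : BoundedContinuousFunction ℝ E₀) (f₁ : BoundedContinuousFunction ℝ E₁) : Prop where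
  continuousOn : ContinuousOn f {z : ℂ | 0 ≤ z.re ∧ z.re ≤ 1}
  bounded : ∃ C : ℝ, ∀ z : ℂ, 0 ≤ z.re → z.re ≤ 1 → ‖f z‖ ≤ C
  holomorphic : DifferentiableOn ℂ f {z : ℂ | 0 < z.re ∧ z.re < 1}
  trace_zero : ∀ t : ℝ, f (t * Complex.I) = i₀ (f₀ t)
  trace_one : ∀ t : ℝ, f (1 + t * Complex.I) = i₁ (f₁ t)

/-- The complex interpolation space `[E₀, E₁]_θ`, as a set of elements of `V = E₀ + E₁`. -/
def interp (i₀ : E₀ →L[ℂ] V) (i₁ : E₁ →L[ℂ] V) (θ : ℝ) : Set V :=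
  {v | ∃ f f₀ f₁, IsCalderon i₀ i₁ f f₀ f₁ ∧ f θ = v}

/-- The norm of `[E₀, E₁]_θ`. -/
def interpNorm (i₀ : E₀ →L[ℂ] V) (i₁ : E₁ →L[ℂ] V) (θ : ℝ) (v : V) : ℝ :=
  sInf {r : ℝ | ∃ f f₀ f₁, IsCalderon i₀ i₁ f f₀ f₁ ∧ f θ = v ∧ r = max ‖f₀‖ ‖f₁‖}

end Interpolation

/-! ### Fractional calculus on `(0, T)` -/

section Fractional

variable {E : Type*} [NormedAddCommGroup E] [NormedSpace ℝ E]

/-- `D_{0+}^{-γ} v`, the left Riemann-Liouville integral of order `γ > 0`. -/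
def leftRLInt (γ : ℝ) (v : ℝ → E) (t : ℝ) : E :=
  (1 / Real.Gamma γ) • ∫ s in (0 : ℝ)..t, ((t - s) ^ (γ - 1)) • v s

/-- `D_{T-}^{-γ} v`, the right Riemann-Liouville integral of order `γ > 0`. -/
def rightRLInt (T γ : ℝ) (v : ℝ → E) (t : ℝ) : E :=
  (1 / Real.Gamma γ) • ∫ s in t..T, ((s - t) ^ (γ - 1)) • v s

/-- `d ∈ L¹(0,T;E)` is the derivative of `v` in the sense of distributions on `(0,T)`. -/
def IsWeakDeriv (T : ℝ) (v d : ℝ → E) : Prop :=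
  IntegrableOn d (Ioo 0 T) ∧
  ∀ φ : ℝ → ℝ, ContDiff ℝ ((⊤ : ℕ∞) : WithTop ℕ∞) φ → HasCompactSupport φ →
    tsupport φ ⊆ Ioo 0 T →
    ∫ t in Ioo 0 T, deriv φ t • v t = - ∫ t in Ioo 0 T, φ t • d t

/-- `d = D_{0+}^α v` for `0 < α < 1`. -/
def IsLeftRLDeriv (T α : ℝ) (v d : ℝ → E) : Prop :=
  IsWeakDeriv T (leftRLInt (1 - α) v) d

/-- `d = D_{T-}^α v` for `0 < α < 1`. -/
def IsRightRLDeriv (T α : ℝ) (v d : ℝ → E) : Prop :=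
  IsWeakDeriv T (rightRLInt T (1 - α) v) (fun t => - d t)

end Fractional

/-- The grid point `t_j = j τ` with `τ = T / J`. -/
def gridPt (T : ℝ) (J j : ℕ) : ℝ := j * (T / J)

/-- The space `W_τ(E)`: functions that are constant on each `(t_{j-1}, t_j)`, `1 ≤ j ≤ J`
(their values at the grid points and outside `(0,T)` play no role). -/
def Wstep (T : ℝ) (J : ℕ) (E : Type*) : Set (ℝ → E) :=
  {V | ∀ j ∈ Finset.Icc 1 J, ∃ c : E, ∀ t ∈ Ioo (gridPt T J (j - 1)) (gridPt T J j), V t = c}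

/-- The discrete Dirac mass `δ̂_T`. -/
def deltaHat (T : ℝ) (J : ℕ) (t : ℝ) : ℝ :=
  open Classical in if T - T / J < t ∧ t < T then (T / J)⁻¹ else 0

/-- The open sector `Σ_ω = {r e^{iγ} : r > 0, -ω < γ < ω}`. -/
def sector (ω : ℝ) : Set ℂ :=
  {z | ∃ r γ : ℝ, 0 < r ∧ -ω < γ ∧ γ < ω ∧ z = r * Complex.exp (Complex.I * γ)}

section Operators

variable {X Y Z : Type*}
  [NormedAddCommGroup X] [InnerProductSpace ℂ X]
  [NormedAddCommGroup Y] [InnerProductSpace ℂ Y]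
  [NormedAddCommGroup Z] [InnerProductSpace ℂ Z]

/-- For bounded `B : X → Y`, the transposed operator `Y → X*`, `⟨B' y, x⟩_X = (y, B x)_Y`.
The dual `X*` consists of the bounded conjugate-linear functionals, because the inner product
`(a, b)` (written `inner ℂ b a` in Mathlib) is linear in `a` and conjugate-linear in `b`.
For the embedding `ι : X → Y` this is the embedding of `Y` into `X*`; the transposed operator of
`A*` is the extension of `A` to `Y → X*`, and that of `A` is the extension of `A*`. -/
def transp (B : X →L[ℂ] Y) : Y →L[ℂ] (X →L⋆[ℂ] ℂ) :=
  LinearMap.mkContinuous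
    { toFun := fun y => (innerSLFlip ℂ y).comp B
      map_add' := fun y y' => by ext x; simp
      map_smul' := fun c y => by ext x; simp }
    ‖B‖ (fun y => by
      refine ContinuousLinearMap.opNorm_le_bound _ (by positivity) (fun x => ?_)
      have h := norm_inner_le_norm (𝕜 := ℂ) (B x) y
      have h2 := B.le_opNorm x
      calc ‖inner ℂ (B x) y‖ ≤ ‖B x‖ * ‖y‖ := h
        _ ≤ (‖B‖ * ‖x‖) * ‖y‖ := by gcongr
        _ = ‖B‖ * ‖y‖ * ‖x‖ := by ring)

theorem transp_apply (B : X →L[ℂ] Y) (y : Y) (x : X) :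
    transp B y x = inner ℂ (B x) y := rfl

/-- `R = R(z, B)` is the resolvent `(z - B)⁻¹ ∈ L(Y)` of the operator `B` in `Y` with domain `X`
(embedded in `Y` by `ι`). -/
def IsResolvent (ι B : X →L[ℂ] Y) (z : ℂ) (R : Y →L[ℂ] Y) : Prop :=
  (∀ y : Y, ∃ x : X, ι x = R y ∧ z • ι x - B x = y) ∧ ∀ x : X, R (z • ι x - B x) = ι x

/-- The resolvent set `ρ(B)` of the operator `B` in `Y` with domain `X`. -/
def resolvSet (ι B : X →L[ℂ] Y) : Set ℂ := {z | ∃ R, IsResolvent ι B z R}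

/-- The standing assumptions on the pair `𝒜`, `𝒜*` of bounded operators `X → Y`. -/
structure IsSectorialPair (ι A Astar : X →L[ℂ] Y) (ω₀ c₀ c₁ M₀ : ℝ) : Prop where
  angle_gt : Real.pi / 2 < ω₀
  angle_lt : ω₀ < Real.pi
  c₀_pos : 0 < c₀
  c₁_pos : 0 < c₁
  M₀_pos : 0 < M₀
  resolv : sector ω₀ ∪ {0} ⊆ resolvSet ι A
  resolv_star : sector ω₀ ∪ {0} ⊆ resolvSet ι Astar
  bound : ∀ z ∈ sector ω₀, ∀ R, IsResolvent ι A z R → ‖R‖ ≤ M₀ / (1 + ‖z‖)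
  bound_star : ∀ z ∈ sector ω₀, ∀ R, IsResolvent ι Astar z R → ‖R‖ ≤ M₀ / (1 + ‖z‖)
  adjoint : ∀ v w : X, inner ℂ (ι w) (A v) = inner ℂ (Astar w) (ι v)
  lower : ∀ v : X, c₀ * ‖v‖ ≤ ‖A v‖
  upper : ∀ v : X, ‖A v‖ ≤ c₁ * ‖v‖
  lower_star : ∀ v : X, c₀ * ‖v‖ ≤ ‖Astar v‖
  upper_star : ∀ v : X, ‖Astar v‖ ≤ c₁ * ‖v‖

/-- `W = S_{α,τ} g`: `W ∈ W_τ(Y)` solves the discontinuous Galerkin equations of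
`(D_{0+}^α - 𝒜) w = g`, `w(0) = 0`, tested with all `V ∈ W_τ(X)`. -/
def IsDiscreteState (ι Astar : X →L[ℂ] Y) (α T : ℝ) (J : ℕ)
    (g : ℝ → (X →L⋆[ℂ] ℂ)) (W : ℝ → Y) : Prop :=
  W ∈ Wstep T J Y ∧
  (α < 1 → ∃ D : ℝ → Y, IsLeftRLDeriv T α W D ∧ ∀ V ∈ Wstep T J X,
    ∫ t in Ioo 0 T, (transp ι (D t) - transp Astar (W t)) (V t)
      = ∫ t in Ioo 0 T, (g t) (V t)) ∧
  (α = 1 → ∀ V ∈ Wstep T J X,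
    transp ι (Function.rightLim W 0) (Function.rightLim V 0)
      + ∑ j ∈ Finset.Icc 1 (J - 1),
          transp ι (Function.rightLim W (gridPt T J j) - Function.leftLim W (gridPt T J j))
            (Function.rightLim V (gridPt T J j))
      - ∫ t in Ioo 0 T, transp Astar (W t) (V t)
      = ∫ t in Ioo 0 T, (g t) (V t))

/-- `W = S*_{α,τ} g`: `W ∈ W_τ(Y)` solves the discontinuous Galerkin equations of
`(D_{T-}^α - 𝒜*) w = g`, `w(T) = 0`, tested with all `V ∈ W_τ(X)`. -/
def IsDiscreteAdjoint (ι A : X →L[ℂ] Y) (α T : ℝ) (J : ℕ)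
    (g : ℝ → (X →L⋆[ℂ] ℂ)) (W : ℝ → Y) : Prop :=
  W ∈ Wstep T J Y ∧
  (α < 1 → ∃ D : ℝ → Y, IsRightRLDeriv T α W D ∧ ∀ V ∈ Wstep T J X,
    ∫ t in Ioo 0 T, (transp ι (D t) - transp A (W t)) (V t)
      = ∫ t in Ioo 0 T, (g t) (V t)) ∧
  (α = 1 → ∀ V ∈ Wstep T J X,
    transp ι (Function.leftLim W T) (Function.leftLim V T)
      + ∑ j ∈ Finset.Icc 1 (J - 1),
          transp ι (Function.leftLim W (gridPt T J j) - Function.rightLim W (gridPt T J j))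
            (Function.leftLim V (gridPt T J j))
      - ∫ t in Ioo 0 T, transp A (W t) (V t)
      = ∫ t in Ioo 0 T, (g t) (V t))

/-- The operator `S_{α,τ}`: the solution of the discrete state equation. -/
def discreteState (ι Astar : X →L[ℂ] Y) (α T : ℝ) (J : ℕ) (g : ℝ → (X →L⋆[ℂ] ℂ)) : ℝ → Y :=
  Classical.epsilon (IsDiscreteState ι Astar α T J g)

/-- The operator `S*_{α,τ}`: the solution of the discrete adjoint equation. -/
def discreteAdjoint (ι A : X →L[ℂ] Y) (α T : ℝ) (J : ℕ) (g : ℝ → (X →L⋆[ℂ] ℂ)) : ℝ → Y :=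
  Classical.epsilon (IsDiscreteAdjoint ι A α T J g)

/-- `R : Z → [X*, Y]_θ` is bounded (`[X*, Y]_0 = X*`, `[X*, Y]_1 = Y`). -/
def IsBoundedIntoInterp (ι : X →L[ℂ] Y) (θ : ℝ) (R : Z →ₗ[ℂ] (X →L⋆[ℂ] ℂ)) : Prop :=
  ∃ C : ℝ, ∀ w : Z,
    R w ∈ interp (ContinuousLinearMap.id ℂ (X →L⋆[ℂ] ℂ)) (transp ι) θ ∧
    interpNorm (ContinuousLinearMap.id ℂ (X →L⋆[ℂ] ℂ)) (transp ι) θ (R w) ≤ C * ‖w‖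

/-- `R* v ∈ Z` for `v ∈ X`: the element with `(R* v, w)_Z = conj ⟨R w, v⟩` for all `w ∈ Z`.
The duality pairing between `[X*, Y]_θ` and `[X, Y]_θ` is the continuous extension of the pairing
between `X*` and `X`, hence is the latter for `v ∈ X`. -/
def controlAdjoint (R : Z →ₗ[ℂ] (X →L⋆[ℂ] ℂ)) (v : X) : Z :=
  Classical.epsilon (fun r : Z => ∀ w : Z, inner ℂ w r = starRingEnd ℂ (R w v))

/-- The space `L²(0,T;Z)`. -/
abbrev L2 (T : ℝ) (Z : Type*) [NormedAddCommGroup Z] :=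
  Lp Z 2 (volume.restrict (Ioo 0 T))

/-- The function `t ↦ R (u t)`. -/
def applyControl {T : ℝ} (R : Z →ₗ[ℂ] (X →L⋆[ℂ] ℂ)) (u : L2 T Z) : ℝ → (X →L⋆[ℂ] ℂ) :=
  fun t => R (u t)

/-- The discrete cost `½ ‖(S_{α,τ} R u)(T-) - y_d‖² + ν/2 ‖u‖²`. -/
def discreteCost (ι Astar : X →L[ℂ] Y) (R : Z →ₗ[ℂ] (X →L⋆[ℂ] ℂ)) (α T : ℝ) (J : ℕ)
    (yd : Y) (ν : ℝ) (u : L2 T Z) : ℝ :=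
  1 / 2 * ‖Function.leftLim (discreteState ι Astar α T J (applyControl R u)) T - yd‖ ^ 2
    + ν / 2 * ‖u‖ ^ 2

end Operators

end

end FracControl

open FracControl

/-!
On each grid interval the unknown of either discrete equation is a single vector. The left
Riemann-Liouville integral of a step function is a combination of the truncated powers
`(t - t_i)_+^(1 - α)`, whose weak derivative is explicit and unique, so testing with step functions
turns the state equation into a causal discrete convolution system in `X*`,
`∑ i, b (k - i) w i - τ 𝒜 w k = ∫ over (t_k, t_{k+1}) of g`, for `k < J` (`isDiscreteState_iff`).
The coefficients are scaled second differences of `x_+^(1 - α)`; for `α = 1` the same formula gives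
the backward differences of the implicit Euler scheme, so both cases are treated together from there
on. The diagonal of the system is `b 0 - τ 𝒜` with `b 0 > 0`. It is an isomorphism `Y → X*`, being
the transpose of the bijection `b 0 - τ 𝒜* : X → Y` supplied by the resolvent set
(`bijective_transp`). Hence the system is solved by time stepping, uniquely, by bounded operators
(`exists_convSol`). Reversing time turns the adjoint equation into a state equation
(`isDiscreteAdjoint_iff_reflect`).

The operator into the interpolation space is bounded into `X*` by the Phragmen-Lindelöf principle
in the strip, so `L u = (S R u)(T-)` is a bounded operator from `L²(0,T;Z)` to `Y`. The cost is
therefore a strongly convex quadratic functional; its minimiser is a projection onto a closed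
convex set, and is characterised by a variational inequality in terms of `L`
(`exists_variational_inequality`). Since the right-hand side of the adjoint equation takes values
in `Y`, its solution takes values in `X` (`IsConvSol.exists_lift`), and may be used as a test
function in the state equation. Summation by parts (`IsConvSol.sum_duality`) then gives `(L v,
Y(T-) - y_d) = ∫ ⟨R v, P⟩`, which is the stated optimality condition.
-/

namespace FracControl

/-! ### Continuity of the control operator -/

section Interpolation

variable {E₀ E₁ V : Type*}
  [NormedAddCommGroup E₀] [NormedSpace ℂ E₀]
  [NormedAddCommGroup E₁] [NormedSpace ℂ E₁]
  [NormedAddCommGroup V] [NormedSpace ℂ V]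

/-- The bound of the three lines theorem, for the norm of the ambient space. -/
theorem IsCalderon.norm_le {i₀ : E₀ →L[ℂ] V} {i₁ : E₁ →L[ℂ] V} {f : ℂ → V}
    {f₀ : BoundedContinuousFunction ℝ E₀} {f₁ : BoundedContinuousFunction ℝ E₁}
    (h : IsCalderon i₀ i₁ f f₀ f₁) {θ : ℝ} (h0 : 0 ≤ θ) (h1 : θ ≤ 1) :
    ‖f θ‖ ≤ max ‖i₀‖ ‖i₁‖ * max ‖f₀‖ ‖f₁‖ := by
  have hK : 0 ≤ max ‖i₀‖ ‖i₁‖ := le_max_of_le_left (norm_nonneg _)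
  obtain ⟨C, hC⟩ := h.bounded
  refine PhragmenLindelof.vertical_strip (a := 0) (b := 1) ?_ ?_ ?_ ?_ (by simpa) (by simpa)
  · refine ⟨h.holomorphic, h.continuousOn.mono ?_⟩
    rw [Complex.closure_preimage_re, closure_Ioo zero_ne_one]
    exact fun z hz => hz
  · refine ⟨0, by simp [Real.pi_pos], 0, ?_⟩
    refine Asymptotics.IsBigO.of_bound C ?_
    refine eventually_inf_principal.mpr (Eventually.of_forall fun z hz => ?_)
    simpa using hC z hz.1.le hz.2.le
  · intro z hz
    have hz' : z = z.im * Complex.I := by apply Complex.ext <;> simp [hz]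
    rw [hz', h.trace_zero]
    exact (i₀.le_opNorm _).trans (mul_le_mul (le_max_left _ _)
      ((f₀.norm_coe_le_norm _).trans (le_max_left _ _)) (norm_nonneg _) hK)
  · intro z hz
    have hz' : z = 1 + z.im * Complex.I := by apply Complex.ext <;> simp [hz]
    rw [hz', h.trace_one]
    exact (i₁.le_opNorm _).trans (mul_le_mul (le_max_right _ _)
      ((f₁.norm_coe_le_norm _).trans (le_max_right _ _)) (norm_nonneg _) hK)

/-- The interpolation space embeds continuously into the sum space. -/
theorem norm_le_interpNorm (i₀ : E₀ →L[ℂ] V) (i₁ : E₁ →L[ℂ] V) {θ : ℝ} (h0 : 0 ≤ θ)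
    (h1 : θ ≤ 1) {v : V} (hv : v ∈ interp i₀ i₁ θ) :
    ‖v‖ ≤ max ‖i₀‖ ‖i₁‖ * interpNorm i₀ i₁ θ v := by
  have hK : 0 ≤ max ‖i₀‖ ‖i₁‖ := le_max_of_le_left (norm_nonneg _)
  obtain ⟨f, f₀, f₁, hf, hfv⟩ := hv
  rw [interpNorm, ← smul_eq_mul, ← Real.sInf_smul_of_nonneg hK]
  refine le_csInf (Set.Nonempty.smul_set ⟨_, f, f₀, f₁, hf, hfv, rfl⟩) ?_
  rintro _ ⟨_, ⟨g, g₀, g₁, hg, rfl, rfl⟩, rfl⟩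
  exact hg.norm_le h0 h1

end Interpolation

section Control

variable {X Y Z : Type*}
  [NormedAddCommGroup X] [InnerProductSpace ℂ X]
  [NormedAddCommGroup Y] [InnerProductSpace ℂ Y]
  [NormedAddCommGroup Z] [InnerProductSpace ℂ Z]

/-- A bounded operator into the interpolation space is bounded into `X*`. -/
theorem IsBoundedIntoInterp.exists_clm {ι : X →L[ℂ] Y} {θ : ℝ} {R : Z →ₗ[ℂ] (X →L⋆[ℂ] ℂ)}
    (h0 : 0 ≤ θ) (h1 : θ ≤ 1) (hR : IsBoundedIntoInterp ι θ R) :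
    ∃ R' : Z →L[ℂ] (X →L⋆[ℂ] ℂ), ∀ w, R' w = R w := by
  obtain ⟨C, hC⟩ := hR
  refine ⟨R.mkContinuous (max ‖ContinuousLinearMap.id ℂ (X →L⋆[ℂ] ℂ)‖ ‖transp ι‖ * C)
    fun w => ?_, fun w => rfl⟩
  refine (norm_le_interpNorm _ _ h0 h1 (hC w).1).trans ?_
  rw [mul_assoc]
  exact mul_le_mul_of_nonneg_left (hC w).2 (le_max_of_le_left (norm_nonneg _))

theorem controlAdjoint_spec [CompleteSpace Z] (R : Z →L[ℂ] (X →L⋆[ℂ] ℂ)) (v : X) (w : Z) :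
    inner ℂ w (controlAdjoint (R : Z →ₗ[ℂ] (X →L⋆[ℂ] ℂ)) v) = starRingEnd ℂ (R w v) := by
  have hex : ∃ r : Z, ∀ w : Z,
      inner ℂ w r = starRingEnd ℂ ((R : Z →ₗ[ℂ] (X →L⋆[ℂ] ℂ)) w v) := by
    refine ⟨(InnerProductSpace.toDual ℂ Z).symm
      ((ContinuousLinearMap.apply' ℂ (starRingEnd ℂ) v).comp R), fun w => ?_⟩
    rw [← inner_conj_symm, InnerProductSpace.toDual_symm_apply]
    rfl
  exact Classical.epsilon_spec hex w

end Control

/-! ### Transposed operators and convolution systems -/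

section Algebra

variable {X Y : Type*}
  [NormedAddCommGroup X] [InnerProductSpace ℂ X]
  [NormedAddCommGroup Y] [InnerProductSpace ℂ Y]

theorem transp_injective {ι : X →L[ℂ] Y} (hιd : DenseRange ι) :
    Function.Injective (transp ι) := by
  intro y y' h
  refine hιd.eq_of_inner_right ℂ fun x => ?_
  exact DFunLike.congr_fun h x

/-- A positive real number lies in the resolvent set of both operators of a sectorial pair;
scaled, this makes `r - s B : X → Y` bijective for all `r, s > 0`. -/
theorem bijective_of_resolvSet {ι B : X →L[ℂ] Y} (hι : Function.Injective ι) {ω : ℝ}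
    (hω : 0 < ω) (hB : sector ω ∪ {0} ⊆ resolvSet ι B) {r s : ℝ} (hr : 0 < r) (hs : 0 < s) :
    Function.Bijective ((r : ℂ) • ι - (s : ℂ) • B) := by
  have hz : ((r / s : ℝ) : ℂ) ∈ resolvSet ι B :=
    hB (Or.inl ⟨r / s, 0, div_pos hr hs, by linarith, hω, by simp⟩)
  obtain ⟨Q, hQ1, hQ2⟩ := hz
  have hs' : (s : ℂ) ≠ 0 := by exact_mod_cast hs.ne'
  have key : ∀ x, ((r : ℂ) • ι - (s : ℂ) • B) x = (s : ℂ) • (((r / s : ℝ) : ℂ) • ι x - B x) := by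
    intro x
    simp only [sub_apply, smul_apply, smul_sub, smul_smul]
    congr 2
    push_cast
    field_simp
  constructor
  · intro x x' h
    rw [key, key] at h
    have h2 := smul_right_injective Y hs' h
    apply hι
    rw [← hQ2 x, ← hQ2 x', h2]
  · intro y
    obtain ⟨x, -, hx⟩ := hQ1 ((s : ℂ)⁻¹ • y)
    exact ⟨x, by rw [key, hx, smul_smul, mul_inv_cancel₀ hs', one_smul]⟩

theorem transp_real_comb (ι B : X →L[ℂ] Y) (r s : ℝ) :
    transp ((r : ℂ) • ι - (s : ℂ) • B) = (r : ℂ) • transp ι - (s : ℂ) • transp B := by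
  ext y x
  simp [transp_apply]

/-- The transposed operator of a bijection `X → Y` is a bijection `Y → X*`: the inverse operator
is bounded by the open mapping theorem, and the functionals on `Y` are represented by vectors. -/
theorem bijective_transp [CompleteSpace X] [CompleteSpace Y] {C : X →L[ℂ] Y}
    (hC : Function.Bijective C) : Function.Bijective (transp C) := by
  constructor
  · exact transp_injective hC.2.denseRange
  · intro l
    let e := ContinuousLinearEquiv.ofBijective C (LinearMap.ker_eq_bot.mpr hC.1)
      (LinearMap.range_eq_top.mpr hC.2)
    let m : Y →L⋆[ℂ] ℂ := l.comp (e.symm : Y →L[ℂ] X)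
    let m' : Y →L[ℂ] ℂ := (starL ℂ : ℂ ≃L⋆[ℂ] ℂ).toContinuousLinearMap.comp m
    refine ⟨(InnerProductSpace.toDual ℂ Y).symm m', ?_⟩
    ext x
    rw [transp_apply, ← inner_conj_symm, InnerProductSpace.toDual_symm_apply]
    have : e.symm (C x) = x := e.symm_apply_apply x
    simp [m', m, this]

end Algebra

section Recursion

variable {F Y : Type*} [NormedAddCommGroup F] [NormedSpace ℂ F]
  [NormedAddCommGroup Y] [NormedSpace ℂ Y]

/-- Time stepping: `recSol Q G b k` sends the data `q` to the `k`-th term `w k` of the sequence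
determined by `w k = Q (q k - ∑ i < k, b (k - i) • G (w i))`. -/
noncomputable def recSol (Q : F →L[ℂ] Y) (G : Y →L[ℂ] F) (b : ℤ → ℝ) :
    ℕ → ((ℕ → F) →L[ℂ] Y)
  | k => Q.comp (ContinuousLinearMap.proj k
      - ∑ i : Fin k, (b ((k : ℤ) - (i : ℕ)) : ℂ) • G.comp (recSol Q G b i))
  decreasing_by exact i.2

theorem recSol_apply (Q : F →L[ℂ] Y) (G : Y →L[ℂ] F) (b : ℤ → ℝ) (k : ℕ) (q : ℕ → F) :
    recSol Q G b k q
      = Q (q k - ∑ i ∈ Finset.range k, (b ((k : ℤ) - i) : ℂ) • G (recSol Q G b i q)) := by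
  rw [recSol, Finset.sum_range (fun i => (b ((k : ℤ) - i) : ℂ) • G (recSol Q G b i q))]
  simp

end Recursion

section System

variable {X Y : Type*}
  [NormedAddCommGroup X] [InnerProductSpace ℂ X]
  [NormedAddCommGroup Y] [InnerProductSpace ℂ Y]

/-- The discrete convolution system
`∑ i < J, b (k - i) w i - τ B' w k = q k` in `X*`, for `k < J`, where `B'` is the transposed
operator of `B`. -/
def IsConvSol (ι B : X →L[ℂ] Y) (b : ℤ → ℝ) (τ : ℝ) (J : ℕ) (q : ℕ → (X →L⋆[ℂ] ℂ))
    (w : ℕ → Y) : Prop :=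
  ∀ k < J, transp ι (∑ i ∈ Finset.range J, (b ((k : ℤ) - i) : ℂ) • w i)
    - (τ : ℂ) • transp B (w k) = q k

/-- Splitting off the diagonal of a causal convolution. -/
theorem sum_causal {F : Type*} [AddCommGroup F] [Module ℂ F] {b : ℤ → ℝ}
    (hb : ∀ n < 0, b n = 0) {J k : ℕ} (hk : k < J) (w : ℕ → F) :
    ∑ i ∈ Finset.range J, (b ((k : ℤ) - i) : ℂ) • w i
      = (b 0 : ℂ) • w k + ∑ i ∈ Finset.range k, (b ((k : ℤ) - i) : ℂ) • w i := by
  rw [← Finset.sum_subset (Finset.range_subset_range.mpr (Nat.succ_le_of_lt hk)),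
    Finset.sum_range_succ, add_comm]
  · simp
  · intro i _ hi
    have : k < i := by simpa using hi
    rw [hb _ (by lia)]
    simp

/-- On `X` the extension of `A*` to `Y → X*` agrees with the original operator. -/
theorem transp_apply_of_adjoint {ι A Astar : X →L[ℂ] Y}
    (hadj : ∀ v w : X, inner ℂ (ι w) (A v) = inner ℂ (Astar w) (ι v)) (x : X) :
    transp A (ι x) = transp ι (Astar x) := by
  ext v
  rw [transp_apply, transp_apply, ← inner_conj_symm, hadj, inner_conj_symm]

/-- Regularity: for data in `Y` the solution of the system for `A` takes values in `X`, and there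
`A'` acts as the operator `A*`. -/
theorem IsConvSol.exists_lift [CompleteSpace X] [CompleteSpace Y] {ι A Astar : X →L[ℂ] Y}
    (hιd : DenseRange ι)
    (hadj : ∀ v w : X, inner ℂ (ι w) (A v) = inner ℂ (Astar w) (ι v)) {b : ℤ → ℝ} {τ : ℝ}
    (hbij : Function.Bijective ((b 0 : ℂ) • ι - (τ : ℂ) • A))
    (hbij' : Function.Bijective ((b 0 : ℂ) • ι - (τ : ℂ) • Astar)) (hb : ∀ n < 0, b n = 0)
    {J : ℕ} {y w : ℕ → Y} (hw : IsConvSol ι A b τ J (fun k => transp ι (y k)) w) :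
    ∃ p : ℕ → X, ∀ k < J, ι (p k) = w k ∧
      ∑ i ∈ Finset.range J, (b ((k : ℤ) - i) : ℂ) • w i - (τ : ℂ) • Astar (p k) = y k := by
  have hlift : ∀ k, k < J → ∃ x, ι x = w k := by
    intro k hk
    obtain ⟨x, hx⟩ := hbij'.2
      (y k - ∑ i ∈ Finset.range k, (b ((k : ℤ) - i) : ℂ) • w i)
    refine ⟨x, (bijective_transp hbij).1 ?_⟩
    have h1 := hw k hk
    rw [sum_causal hb hk, map_add, map_smul] at h1
    have h2 := congrArg (transp ι) hx
    simp only [sub_apply, smul_apply, map_sub, map_smul] at h2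
    rw [transp_real_comb]
    simp only [sub_apply, smul_apply, transp_apply_of_adjoint hadj]
    rw [h2]
    refine (sub_eq_of_eq_add (Eq.trans h1.symm ?_))
    abel
  choose! p hp using hlift
  refine ⟨p, fun k hk => ⟨hp k hk, transp_injective hιd ?_⟩⟩
  rw [map_sub, map_smul, ← transp_apply_of_adjoint hadj, hp k hk]
  exact hw k hk

/-- Duality between the state system and the time-reversed adjoint system: summation by parts
moves the discrete convolution from `w` to the reversed sequence `p`. -/
theorem IsConvSol.sum_duality {ι Astar : X →L[ℂ] Y} {b : ℤ → ℝ} {τ : ℝ} {J : ℕ}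
    {q : ℕ → (X →L⋆[ℂ] ℂ)} {w y : ℕ → Y} {p : ℕ → X} (hw : IsConvSol ι Astar b τ J q w)
    (hp : ∀ k < J, ∑ i ∈ Finset.range J, (b ((k : ℤ) - i) : ℂ) • ι (p i)
      - (τ : ℂ) • Astar (p k) = y k) :
    ∑ k ∈ Finset.range J, q k (p (J - 1 - k))
      = ∑ k ∈ Finset.range J, inner ℂ (y (J - 1 - k)) (w k) := by
  have h1 : ∀ k ∈ Finset.range J, q k (p (J - 1 - k))
      = ∑ i ∈ Finset.range J, (b ((k : ℤ) - i) : ℂ) * inner ℂ (ι (p (J - 1 - k))) (w i)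
        - (τ : ℂ) * inner ℂ (Astar (p (J - 1 - k))) (w k) := by
    intro k hk
    rw [← hw k (Finset.mem_range.mp hk)]
    simp [transp_apply]
  have h2 : ∀ k ∈ Finset.range J, inner ℂ (y (J - 1 - k)) (w k)
      = ∑ i ∈ Finset.range J, (b ((i : ℤ) - k) : ℂ) * inner ℂ (ι (p (J - 1 - i))) (w k)
        - (τ : ℂ) * inner ℂ (Astar (p (J - 1 - k))) (w k) := by
    intro k hk
    have hk' := Finset.mem_range.mp hk
    rw [← hp (J - 1 - k) (by lia), inner_sub_left, sum_inner, ← Finset.sum_range_reflect]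
    congr 1
    · refine Finset.sum_congr rfl fun i hi => ?_
      have hi' := Finset.mem_range.mp hi
      rw [inner_smul_left, Complex.conj_ofReal]
      congr 3
      lia
    · rw [inner_smul_left, Complex.conj_ofReal]
  rw [Finset.sum_congr rfl h1, Finset.sum_congr rfl h2, Finset.sum_sub_distrib,
    Finset.sum_sub_distrib, Finset.sum_comm]

variable [CompleteSpace X] [CompleteSpace Y]

/-- A causal convolution system with boundedly invertible diagonal has a unique solution, which
depends linearly and continuously on the data. -/
theorem exists_convSol {ι B : X →L[ℂ] Y} {b : ℤ → ℝ} {τ : ℝ}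
    (hbij : Function.Bijective ((b 0 : ℂ) • ι - (τ : ℂ) • B)) (hb : ∀ n < 0, b n = 0) (J : ℕ) :
    ∃ S : ℕ → ((ℕ → (X →L⋆[ℂ] ℂ)) →L[ℂ] Y), ∀ q,
      IsConvSol ι B b τ J q (fun k => S k q) ∧
      ∀ w, IsConvSol ι B b τ J q w → ∀ k < J, w k = S k q := by
  have hbij' := bijective_transp hbij
  let e := ContinuousLinearEquiv.ofBijective (transp ((b 0 : ℂ) • ι - (τ : ℂ) • B))
    (LinearMap.ker_eq_bot.mpr hbij'.1) (LinearMap.range_eq_top.mpr hbij'.2)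
  have he : ∀ y, e y = (b 0 : ℂ) • transp ι y - (τ : ℂ) • transp B y := by
    intro y
    change transp ((b 0 : ℂ) • ι - (τ : ℂ) • B) y = _
    rw [transp_real_comb]; rfl
  have hstep : ∀ (q : ℕ → (X →L⋆[ℂ] ℂ)) (w : ℕ → Y), ∀ k < J,
      (transp ι (∑ i ∈ Finset.range J, (b ((k : ℤ) - i) : ℂ) • w i)
        - (τ : ℂ) • transp B (w k) = q k ↔
      w k = e.symm (q k - ∑ i ∈ Finset.range k, (b ((k : ℤ) - i) : ℂ) • transp ι (w i))) := by
    intro q w k hk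
    rw [ContinuousLinearEquiv.eq_symm_apply, he, sum_causal hb hk, map_add, map_sum, map_smul,
      eq_sub_iff_add_eq]
    simp only [map_smul]
    constructor <;> intro h <;> rw [← h] <;> abel
  refine ⟨recSol (e.symm : _ →L[ℂ] Y) (transp ι) b, fun q => ⟨fun k hk => ?_, fun w hw => ?_⟩⟩
  · exact (hstep q (fun k => recSol (e.symm : _ →L[ℂ] Y) (transp ι) b k q) k hk).mpr
      (recSol_apply _ _ _ _ _)
  · intro k
    induction k using Nat.strong_induction_on with
    | _ k ih =>
      intro hk
      rw [(hstep q w k hk).mp (hw k hk), recSol_apply]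
      have hsum : ∑ i ∈ Finset.range k, (b ((k : ℤ) - i) : ℂ) • transp ι (w i)
          = ∑ i ∈ Finset.range k, (b ((k : ℤ) - i) : ℂ) •
            transp ι (recSol (e.symm : _ →L[ℂ] Y) (transp ι) b i q) :=
        Finset.sum_congr rfl fun i hi => by
          rw [ih i (Finset.mem_range.mp hi) ((Finset.mem_range.mp hi).trans hk)]
      rw [hsum]
      rfl

end System

/-! ### Weak derivatives and truncated powers -/

section WeakDeriv

variable {E : Type*} [NormedAddCommGroup E] [NormedSpace ℝ E] [CompleteSpace E]

/-- A continuous function that is differentiable off a countable set with integrable derivative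
has that derivative as weak derivative. -/
theorem isWeakDeriv_of_hasDerivAt {T : ℝ} (hT : 0 ≤ T) {v d : ℝ → E} {s : Set ℝ}
    (hs : s.Countable) (hc : ContinuousOn v (Icc 0 T))
    (hd : ∀ t ∈ Ioo 0 T \ s, HasDerivAt v (d t) t) (hi : IntervalIntegrable d volume 0 T) :
    IsWeakDeriv T v d := by
  refine ⟨((intervalIntegrable_iff_integrableOn_Ioo_of_le hT).mp hi), fun φ hφ _ hsupp => ?_⟩
  have hφd : Continuous (deriv φ) := hφ.continuous_deriv (by exact_mod_cast le_top)
  have h0 : φ 0 = 0 := image_eq_zero_of_notMem_tsupport fun h => lt_irrefl _ (hsupp h).1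
  have h1 : φ T = 0 := image_eq_zero_of_notMem_tsupport fun h => lt_irrefl _ (hsupp h).2
  have hi1 : IntervalIntegrable (fun t => φ t • d t) volume 0 T :=
    hi.continuousOn_smul hφ.continuous.continuousOn
  have hi2 : IntervalIntegrable (fun t => deriv φ t • v t) volume 0 T := by
    refine ContinuousOn.intervalIntegrable ?_
    rw [uIcc_of_le hT]
    exact hφd.continuousOn.smul hc
  have key := integral_eq_of_hasDerivAt_off_countable_of_le (fun t => φ t • v t)
    (fun t => φ t • d t + deriv φ t • v t) hT hs (hφ.continuous.continuousOn.smul hc)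
    (fun t ht => ((hφ.differentiable (by simp)) t).hasDerivAt.smul (hd t ht)) (hi1.add hi2)
  rw [intervalIntegral.integral_add hi1 hi2] at key
  simp only [h0, h1, zero_smul, sub_zero] at key
  rw [← integral_Ioc_eq_integral_Ioo, ← integral_Ioc_eq_integral_Ioo,
    ← intervalIntegral.integral_of_le hT, ← intervalIntegral.integral_of_le hT]
  exact eq_neg_of_add_eq_zero_right key

theorem IsWeakDeriv.ae_eq {T : ℝ} {v v' d d' : ℝ → E} (h : IsWeakDeriv T v d)
    (h' : IsWeakDeriv T v' d') (hv : ∀ t ∈ Ioo 0 T, v t = v' t) :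
    d =ᵐ[volume.restrict (Ioo 0 T)] d' := by
  have key : ∀ᵐ t, t ∈ Ioo 0 T → (d - d') t = 0 := by
    refine isOpen_Ioo.ae_eq_zero_of_integral_contDiff_smul_eq_zero
      (h.1.sub h'.1).locallyIntegrableOn fun φ hφ hc hs => ?_
    have hint : ∀ e : ℝ → E, IntegrableOn e (Ioo 0 T) →
        IntegrableOn (fun t => φ t • e t) (Ioo 0 T) := by
      intro e he
      obtain ⟨C, hC⟩ := hc.exists_bound_of_continuous hφ.continuous
      exact Integrable.bdd_smul he C hφ.continuous.aestronglyMeasurable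
        (Eventually.of_forall hC)
    have e1 := h.2 φ hφ hc hs
    have e2 := h'.2 φ hφ hc hs
    rw [← setIntegral_eq_integral_of_forall_compl_eq_zero (s := Ioo 0 T)]
    · simp only [Pi.sub_apply, smul_sub]
      rw [integral_sub (hint d h.1) (hint d' h'.1), sub_eq_zero, ← neg_inj, ← e1, ← e2]
      exact setIntegral_congr_fun measurableSet_Ioo fun t ht => by simp only [hv t ht]
    · intro t ht
      rw [image_eq_zero_of_notMem_tsupport (fun h => ht (hs h)), zero_smul]
  exact (ae_restrict_iff' measurableSet_Ioo).mpr
    (key.mono fun t ht hmem => sub_eq_zero.mp (ht hmem))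

end WeakDeriv

section PosPow

/-- The truncated power `x_+^β`, with the value `0` for `x ≤ 0`; for `β = 0` this is the
Heaviside function. -/
noncomputable def posPow (β x : ℝ) : ℝ :=
  open Classical in if 0 < x then x ^ β else 0

theorem posPow_of_pos {β x : ℝ} (hx : 0 < x) : posPow β x = x ^ β := if_pos hx

theorem posPow_of_nonpos {β x : ℝ} (hx : x ≤ 0) : posPow β x = 0 := if_neg hx.not_gt

theorem posPow_mul {β a : ℝ} (ha : 0 < a) (x : ℝ) : posPow β (a * x) = a ^ β * posPow β x := by
  rcases lt_or_ge 0 x with hx | hx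
  · rw [posPow_of_pos hx, posPow_of_pos (mul_pos ha hx), Real.mul_rpow ha.le hx.le]
  · rw [posPow_of_nonpos hx, posPow_of_nonpos (mul_nonpos_of_nonneg_of_nonpos ha.le hx), mul_zero]

theorem continuous_posPow {β : ℝ} (hβ : 0 < β) : Continuous (posPow β) := by
  have : posPow β = fun x => (max x 0) ^ β := by
    funext x
    rcases lt_or_ge 0 x with hx | hx
    · rw [posPow_of_pos hx, max_eq_left hx.le]
    · rw [posPow_of_nonpos hx, max_eq_right hx, Real.zero_rpow hβ.ne']
  rw [this]
  exact (continuous_id.max continuous_const).rpow_const fun _ => Or.inr hβ.le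

theorem hasDerivAt_posPow {β x : ℝ} (hx : x ≠ 0) :
    HasDerivAt (posPow β) (β * posPow (β - 1) x) x := by
  rcases lt_or_gt_of_ne hx with h | h
  · rw [posPow_of_nonpos h.le, mul_zero]
    exact (hasDerivAt_const x (0 : ℝ)).congr_of_eventuallyEq
      ((eventually_lt_nhds h).mono fun y hy => posPow_of_nonpos hy.le)
  · rw [posPow_of_pos h]
    exact (Real.hasDerivAt_rpow_const (Or.inl hx)).congr_of_eventuallyEq
      ((eventually_gt_nhds h).mono fun y hy => posPow_of_pos hy)

theorem intervalIntegrable_posPow {β : ℝ} (hβ : 0 < β) (a b : ℝ) :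
    IntervalIntegrable (posPow (β - 1)) volume a b := by
  have : posPow (β - 1) = (Ioi 0).indicator fun x : ℝ => x ^ (β - 1) := by
    funext x
    rcases lt_or_ge 0 x with hx | hx
    · rw [posPow_of_pos hx, indicator_of_mem (mem_Ioi.mpr hx)]
    · rw [posPow_of_nonpos hx, indicator_of_notMem (by simpa using hx)]
  rw [this, intervalIntegrable_iff]
  exact (intervalIntegrable_iff.mp
    (intervalIntegral.intervalIntegrable_rpow' (by linarith))).indicator measurableSet_Ioi

/-- The Riemann-Liouville integral of a Heaviside function. -/
theorem integral_rpow_mul_posPow {β a t : ℝ} (hβ : 0 < β) (ha : 0 ≤ a) (ht : 0 ≤ t) :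
    ∫ s in (0 : ℝ)..t, (t - s) ^ (β - 1) * posPow 0 (s - a) = posPow β (t - a) / β := by
  have hint : ∀ x y, IntervalIntegrable (fun s => (t - s) ^ (β - 1)) volume x y := by
    intro x y
    simpa using (intervalIntegral.intervalIntegrable_rpow' (a := t - x) (b := t - y)
      (r := β - 1) (by linarith)).comp_sub_left t
  rcases le_or_gt t a with h | h
  · rw [posPow_of_nonpos (by linarith), zero_div]
    refine intervalIntegral.integral_zero_ae (Eventually.of_forall fun s hs => ?_)
    rw [uIoc_of_le ht] at hs
    rw [posPow_of_nonpos (by linarith [hs.2]), mul_zero]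
  · have e1 : EqOn (fun s => (t - s) ^ (β - 1) * posPow 0 (s - a)) (fun _ => 0) (uIoc 0 a) := by
      intro s hs
      rw [uIoc_of_le ha] at hs
      simp [posPow_of_nonpos (β := 0) (sub_nonpos.mpr hs.2)]
    have e2 : EqOn (fun s => (t - s) ^ (β - 1) * posPow 0 (s - a))
        (fun s => (t - s) ^ (β - 1)) (uIoc a t) := by
      intro s hs
      rw [uIoc_of_le h.le] at hs
      simp [posPow_of_pos (β := 0) (sub_pos.mpr hs.1)]
    rw [← intervalIntegral.integral_add_adjacent_intervals (b := a)
      ((intervalIntegrable_congr e1).mpr intervalIntegrable_const)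
      ((intervalIntegrable_congr e2).mpr (hint a t)),
      intervalIntegral.integral_congr_ae (Eventually.of_forall e1),
      intervalIntegral.integral_congr_ae (Eventually.of_forall e2),
      intervalIntegral.integral_comp_sub_left (fun x => x ^ (β - 1)),
      integral_rpow (Or.inl (by linarith)), posPow_of_pos (sub_pos.mpr h)]
    simp [Real.zero_rpow hβ.ne']

end PosPow

/-! ### Step functions on the grid and their fractional derivatives -/

section Steps

variable {E : Type*} {T : ℝ} {J : ℕ}

/-- `W` takes the value `w k` on the `k`-th open grid interval `(t_k, t_{k+1})`, `0 ≤ k < J`. -/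
def HasSteps (T : ℝ) (J : ℕ) (W : ℝ → E) (w : ℕ → E) : Prop :=
  ∀ k < J, ∀ t ∈ Ioo (gridPt T J k) (gridPt T J (k + 1)), W t = w k

/-- The step function with values `w` on the grid intervals. -/
noncomputable def stepFun (T : ℝ) (J : ℕ) (w : ℕ → E) (t : ℝ) : E := w ⌊t / (T / J)⌋₊

theorem gridPt_zero : gridPt T J 0 = 0 := by simp [gridPt]

theorem gridPt_self (hJ : 0 < J) : gridPt T J J = T := by
  have : (J : ℝ) ≠ 0 := by positivity
  simp only [gridPt]
  field_simp

theorem step_pos (hT : 0 < T) (hJ : 0 < J) : 0 < T / J := by positivity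

theorem gridPt_succ (k : ℕ) : gridPt T J (k + 1) = gridPt T J k + T / J := by
  simp only [gridPt]
  push_cast
  ring

theorem gridPt_lt (hT : 0 < T) (hJ : 0 < J) (k : ℕ) : gridPt T J k < gridPt T J (k + 1) := by
  have := step_pos hT hJ
  rw [gridPt_succ]
  linarith

theorem gridPt_mono (hT : 0 < T) (hJ : 0 < J) : Monotone (gridPt T J) :=
  monotone_nat_of_le_succ fun k => (gridPt_lt hT hJ k).le

theorem gridPt_nonneg (hT : 0 < T) (hJ : 0 < J) (k : ℕ) : 0 ≤ gridPt T J k := by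
  rw [← gridPt_zero (T := T) (J := J)]
  exact gridPt_mono hT hJ (Nat.zero_le k)

theorem gridPt_le (hT : 0 < T) (hJ : 0 < J) {k : ℕ} (hk : k ≤ J) : gridPt T J k ≤ T := by
  conv_rhs => rw [← gridPt_self (T := T) hJ]
  exact gridPt_mono hT hJ hk

theorem Ioo_gridPt_subset (hT : 0 < T) (hJ : 0 < J) {k : ℕ} (hk : k < J) :
    Ioo (gridPt T J k) (gridPt T J (k + 1)) ⊆ Ioo 0 T :=
  Ioo_subset_Ioo (gridPt_nonneg hT hJ k) (gridPt_le hT hJ hk)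

theorem mem_Wstep_iff (hT : 0 < T) (hJ : 0 < J) {W : ℝ → E} :
    W ∈ Wstep T J E ↔ ∃ w, HasSteps T J W w := by
  constructor
  · intro h
    refine ⟨fun k => W ((gridPt T J k + gridPt T J (k + 1)) / 2), fun k hk t ht => ?_⟩
    obtain ⟨c, hc⟩ := h (k + 1) (Finset.mem_Icc.mpr ⟨by lia, hk⟩)
    have := gridPt_lt hT hJ k
    rw [Nat.add_sub_cancel] at hc
    exact (hc t ht).trans (hc _ ⟨by linarith, by linarith⟩).symm
  · rintro ⟨w, hw⟩ j hj
    obtain ⟨h1, h2⟩ := Finset.mem_Icc.mp hj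
    refine ⟨w (j - 1), fun t ht => hw (j - 1) (by lia) t ?_⟩
    rwa [Nat.sub_add_cancel h1]

theorem hasSteps_stepFun (hT : 0 < T) (hJ : 0 < J) (w : ℕ → E) :
    HasSteps T J (stepFun T J w) w := by
  intro k hk t ht
  have h := step_pos hT hJ
  have : ⌊t / (T / J)⌋₊ = k := by
    rw [Nat.floor_eq_iff (div_nonneg ((gridPt_nonneg hT hJ k).trans ht.1.le) h.le),
      le_div_iff₀ h, div_lt_iff₀ h]
    refine ⟨ht.1.le, ?_⟩
    simpa [gridPt] using ht.2
  rw [stepFun, this]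

theorem HasSteps.comp {F : Type*} {W : ℝ → E} {w : ℕ → E} (h : HasSteps T J W w) (f : E → F) :
    HasSteps T J (fun t => f (W t)) (fun k => f (w k)) :=
  fun k hk t ht => congrArg f (h k hk t ht)

theorem ae_exists_mem_grid (hT : 0 < T) (hJ : 0 < J) :
    ∀ᵐ t ∂(volume.restrict (Ioo 0 T)),
      ∃ k < J, t ∈ Ioo (gridPt T J k) (gridPt T J (k + 1)) := by
  have h := step_pos hT hJ
  have h0 : ∀ᵐ t, t ∉ range (gridPt T J) := (countable_range _).ae_notMem _
  filter_upwards [ae_restrict_mem measurableSet_Ioo, ae_restrict_of_ae h0] with t ht hg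
  have hle : gridPt T J ⌊t / (T / J)⌋₊ ≤ t := by
    rw [gridPt, ← le_div_iff₀ h]
    exact Nat.floor_le (div_nonneg ht.1.le h.le)
  have hlt : t < gridPt T J (⌊t / (T / J)⌋₊ + 1) := by
    rw [gridPt, ← div_lt_iff₀ h]
    push_cast
    exact Nat.lt_floor_add_one _
  refine ⟨⌊t / (T / J)⌋₊, ?_, lt_of_le_of_ne hle fun h => hg ⟨_, h⟩, hlt⟩
  by_contra hcon
  have := gridPt_mono hT hJ (not_lt.mp hcon)
  rw [gridPt_self hJ] at this
  linarith [ht.2]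

theorem HasSteps.ae_eq (hT : 0 < T) (hJ : 0 < J) {W W' : ℝ → E} {w w' : ℕ → E}
    (h : HasSteps T J W w) (h' : HasSteps T J W' w') (hw : ∀ k < J, w k = w' k) :
    W =ᵐ[volume.restrict (Ioo 0 T)] W' := by
  filter_upwards [ae_exists_mem_grid hT hJ] with t ⟨k, hk, ht⟩
  rw [h k hk t ht, h' k hk t ht, hw k hk]

section Limits

variable [TopologicalSpace E] [T2Space E]

theorem HasSteps.rightLim_eq (hT : 0 < T) (hJ : 0 < J) {W : ℝ → E} {w : ℕ → E}
    (h : HasSteps T J W w) {k : ℕ} (hk : k < J) :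
    Function.rightLim W (gridPt T J k) = w k := by
  refine rightLim_eq_of_tendsto (tendsto_const_nhds.congr' ?_)
  filter_upwards [Ioo_mem_nhdsGT (gridPt_lt hT hJ k)] with t ht
  exact (h k hk t ht).symm

theorem HasSteps.leftLim_eq (hT : 0 < T) (hJ : 0 < J) {W : ℝ → E} {w : ℕ → E}
    (h : HasSteps T J W w) {k : ℕ} (hk : k < J) :
    Function.leftLim W (gridPt T J (k + 1)) = w k := by
  refine leftLim_eq_of_tendsto (tendsto_const_nhds.congr' ?_)
  filter_upwards [Ioo_mem_nhdsLT (gridPt_lt hT hJ k)] with t ht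
  exact (h k hk t ht).symm

theorem HasSteps.rightLim_zero (hT : 0 < T) (hJ : 0 < J) {W : ℝ → E} {w : ℕ → E}
    (h : HasSteps T J W w) : Function.rightLim W 0 = w 0 := by
  rw [← gridPt_zero (T := T) (J := J)]
  exact h.rightLim_eq hT hJ hJ

theorem HasSteps.leftLim_last (hT : 0 < T) (hJ : 0 < J) {W : ℝ → E} {w : ℕ → E}
    (h : HasSteps T J W w) : Function.leftLim W T = w (J - 1) := by
  have := h.leftLim_eq hT hJ (k := J - 1) (by lia)
  rwa [Nat.sub_add_cancel hJ, gridPt_self hJ] at this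

end Limits

section Integrals

variable [NormedAddCommGroup E]

theorem integrableOn_of_grid (hT : 0 < T) (hJ : 0 < J) {f : ℝ → E}
    (h : ∀ k < J, IntegrableOn f (Ioo (gridPt T J k) (gridPt T J (k + 1)))) :
    IntegrableOn f (Ioo 0 T) := by
  have hU : (⋃ k ∈ Finset.range J, Ioo (gridPt T J k) (gridPt T J (k + 1)))
      =ᵐ[volume] Ioo 0 T := by
    refine eventuallyLE_antisymm_iff.mpr ⟨?_, ?_⟩
    · refine (iUnion₂_subset fun k hk => ?_).eventuallyLE
      exact Ioo_gridPt_subset hT hJ (Finset.mem_range.mp hk)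
    · filter_upwards [(ae_restrict_iff' measurableSet_Ioo).mp (ae_exists_mem_grid hT hJ)]
        with t ht hmem
      obtain ⟨k, hk, hkt⟩ := ht hmem
      exact mem_iUnion₂.mpr ⟨k, Finset.mem_range.mpr hk, hkt⟩
  rw [← integrableOn_congr_set_ae hU, integrableOn_finset_iUnion]
  exact fun k hk => h k (Finset.mem_range.mp hk)

theorem HasSteps.integrableOn (hT : 0 < T) (hJ : 0 < J) {W : ℝ → E} {w : ℕ → E}
    (h : HasSteps T J W w) : IntegrableOn W (Ioo 0 T) :=
  integrableOn_of_grid hT hJ fun k hk => (integrableOn_const (C := w k) (by simp)).congr_fun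
    (fun t ht => (h k hk t ht).symm) measurableSet_Ioo

variable [NormedSpace ℝ E]

theorem integral_Ioo_eq_sum (hT : 0 < T) (hJ : 0 < J) {f : ℝ → E}
    (hf : IntegrableOn f (Ioo 0 T)) :
    ∫ t in Ioo 0 T, f t
      = ∑ k ∈ Finset.range J, ∫ t in Ioo (gridPt T J k) (gridPt T J (k + 1)), f t := by
  have hint : ∀ k < J, IntervalIntegrable f volume (gridPt T J k) (gridPt T J (k + 1)) :=
    fun k hk => (intervalIntegrable_iff_integrableOn_Ioo_of_le (gridPt_lt hT hJ k).le).mpr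
      (hf.mono_set (Ioo_gridPt_subset hT hJ hk))
  have key := intervalIntegral.sum_integral_adjacent_intervals hint
  rw [gridPt_zero, gridPt_self hJ, intervalIntegral.integral_of_le hT.le,
    integral_Ioc_eq_integral_Ioo] at key
  rw [← key]
  refine Finset.sum_congr rfl fun k _ => ?_
  rw [intervalIntegral.integral_of_le (gridPt_lt hT hJ k).le, integral_Ioc_eq_integral_Ioo]

end Integrals

end Steps

section StepRL

variable {E : Type*} [NormedAddCommGroup E] [NormedSpace ℝ E] {T : ℝ} {J : ℕ}

/-- The Riemann-Liouville integral of order `β` of the step function with values `w`. -/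
noncomputable def stepRLInt (T : ℝ) (J : ℕ) (β : ℝ) (w : ℕ → E) (t : ℝ) : E :=
  ∑ i ∈ Finset.range J, ((1 / Real.Gamma (β + 1)) *
    (posPow β (t - gridPt T J i) - posPow β (t - gridPt T J (i + 1)))) • w i

/-- The derivative of `stepRLInt` off the grid. -/
noncomputable def stepRLDeriv (T : ℝ) (J : ℕ) (β : ℝ) (w : ℕ → E) (t : ℝ) : E :=
  ∑ i ∈ Finset.range J, ((1 / Real.Gamma (β + 1)) *
    (β * posPow (β - 1) (t - gridPt T J i) - β * posPow (β - 1) (t - gridPt T J (i + 1)))) • w i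

/-- The coefficients of the discrete convolution produced by the Riemann-Liouville derivative of
order `1 - β` on a grid of step `τ`: scaled second differences of `x_+^β`. For `β = 0` they are
those of the backward difference quotient. -/
noncomputable def convCoeff (β τ : ℝ) (n : ℤ) : ℝ :=
  τ ^ β / Real.Gamma (β + 1) * (posPow β (n + 1) - 2 * posPow β n + posPow β (n - 1))

theorem convCoeff_neg {β τ : ℝ} {n : ℤ} (hn : n < 0) : convCoeff β τ n = 0 := by
  have h : (n : ℝ) ≤ -1 := by exact_mod_cast Int.le_sub_one_of_lt hn
  simp [convCoeff, posPow_of_nonpos (β := β) (show (n : ℝ) + 1 ≤ 0 by linarith),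
    posPow_of_nonpos (β := β) (show (n : ℝ) ≤ 0 by linarith),
    posPow_of_nonpos (β := β) (show (n : ℝ) - 1 ≤ 0 by linarith)]

theorem convCoeff_zero_pos {β τ : ℝ} (hβ : 0 ≤ β) (hτ : 0 < τ) : 0 < convCoeff β τ 0 := by
  have : 0 < Real.Gamma (β + 1) := Real.Gamma_pos_of_pos (by linarith)
  have h2 : posPow β 1 = 1 := by rw [posPow_of_pos one_pos, Real.one_rpow]
  simp only [convCoeff, Int.cast_zero, zero_add, h2, posPow_of_nonpos le_rfl,
    posPow_of_nonpos (show (0 : ℝ) - 1 ≤ 0 by norm_num)]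
  positivity

theorem posPow_zero_sub_gridPt (hT : 0 < T) (hJ : 0 < J) {k i : ℕ} {t : ℝ}
    (ht : t ∈ Ioo (gridPt T J k) (gridPt T J (k + 1))) :
    posPow 0 (t - gridPt T J i) = if i ≤ k then 1 else 0 := by
  split_ifs with h
  · rw [posPow_of_pos (by linarith [gridPt_mono hT hJ h, ht.1]), Real.rpow_zero]
  · exact posPow_of_nonpos (by linarith [gridPt_mono hT hJ (show k + 1 ≤ i by lia), ht.2])

theorem continuous_stepRLInt {β : ℝ} (hβ : 0 < β) (w : ℕ → E) :
    Continuous (stepRLInt T J β w) := by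
  have := continuous_posPow hβ
  unfold stepRLInt
  fun_prop

theorem hasDerivAt_stepRLInt {β : ℝ} (w : ℕ → E) {t : ℝ} (ht : t ∉ range (gridPt T J)) :
    HasDerivAt (stepRLInt T J β w) (stepRLDeriv T J β w t) t := by
  have h : ∀ i, HasDerivAt (fun t => posPow β (t - gridPt T J i))
      (β * posPow (β - 1) (t - gridPt T J i)) t := fun i => by
    have h1 := (hasDerivAt_posPow (β := β) (x := t - gridPt T J i)
      (sub_ne_zero.mpr fun e => ht ⟨i, e.symm⟩)).comp t ((hasDerivAt_id t).sub_const _)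
    simpa [Function.comp_def] using h1
  exact HasDerivAt.fun_sum fun i _ => (((h i).sub (h (i + 1))).const_mul _).smul_const _

theorem intervalIntegrable_stepRLDeriv {β : ℝ} (hβ : 0 < β) (w : ℕ → E) (a b : ℝ) :
    IntervalIntegrable (stepRLDeriv T J β w) volume a b := by
  have h : ∀ c, IntervalIntegrable (fun t => posPow (β - 1) (t - c)) volume a b := fun c => by
    simpa using (intervalIntegrable_posPow hβ (a - c) (b - c)).comp_sub_right c
  rw [show stepRLDeriv T J β w = ∑ i ∈ Finset.range J, fun t => ((1 / Real.Gamma (β + 1)) *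
    (β * posPow (β - 1) (t - gridPt T J i) - β * posPow (β - 1) (t - gridPt T J (i + 1)))) • w i
    from funext fun t => by simp only [stepRLDeriv, Finset.sum_apply]]
  exact IntervalIntegrable.sum _ fun i _ =>
    ((((h _).const_mul _).sub ((h _).const_mul _)).const_mul _).smul_continuousOn
      continuousOn_const

variable [CompleteSpace E]

theorem HasSteps.leftRLInt_eq (hT : 0 < T) (hJ : 0 < J) {W : ℝ → E} {w : ℕ → E}
    (h : HasSteps T J W w) {β : ℝ} (hβ : 0 < β) {t : ℝ} (ht : t ∈ Ioo 0 T) :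
    leftRLInt β W t = stepRLInt T J β w t := by
  -- On `(0, T)`, `W` is a combination of differences of shifted Heaviside functions.
  have e1 : ∀ᵐ s ∂volume, s ∈ uIoc 0 t → (t - s) ^ (β - 1) • W s
      = ∑ i ∈ Finset.range J, ((t - s) ^ (β - 1) * posPow 0 (s - gridPt T J i)
        - (t - s) ^ (β - 1) * posPow 0 (s - gridPt T J (i + 1))) • w i := by
    filter_upwards [(ae_restrict_iff' measurableSet_Ioo).mp (ae_exists_mem_grid hT hJ)]
      with s hs hmem
    rw [uIoc_of_le ht.1.le] at hmem
    obtain ⟨k, hk, hks⟩ := hs ⟨hmem.1, hmem.2.trans_lt ht.2⟩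
    rw [h k hk s hks, Finset.sum_eq_single_of_mem k (Finset.mem_range.mpr hk)]
    · simp [posPow_zero_sub_gridPt hT hJ hks]
    · intro i _ hik
      have : i ≤ k ↔ i + 1 ≤ k := by lia
      simp [posPow_zero_sub_gridPt hT hJ hks, this]
  have hint : ∀ a, IntervalIntegrable
      (fun s => (t - s) ^ (β - 1) * posPow 0 (s - a)) volume 0 t := by
    intro a
    have h0 : IntervalIntegrable (fun s => (t - s) ^ (β - 1)) volume 0 t := by
      simpa using (intervalIntegral.intervalIntegrable_rpow' (a := t - 0) (b := t - t)
        (r := β - 1) (by linarith)).comp_sub_left t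
    have h1 : (fun s => (t - s) ^ (β - 1) * posPow 0 (s - a))
        = (Ioi a).indicator fun s => (t - s) ^ (β - 1) := by
      funext s
      rcases lt_or_ge a s with hs | hs
      · rw [posPow_of_pos (by linarith), indicator_of_mem (mem_Ioi.mpr hs), Real.rpow_zero,
          mul_one]
      · rw [posPow_of_nonpos (by linarith), indicator_of_notMem (by simpa using hs), mul_zero]
    rw [h1, intervalIntegrable_iff]
    exact (intervalIntegrable_iff.mp h0).indicator measurableSet_Ioi
  have hΓ : Real.Gamma (β + 1) = β * Real.Gamma β := Real.Gamma_add_one hβ.ne'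
  rw [leftRLInt, intervalIntegral.integral_congr_ae e1, intervalIntegral.integral_finsetSum
    fun i _ => ?_, stepRLInt, Finset.smul_sum]
  · refine Finset.sum_congr rfl fun i _ => ?_
    rw [intervalIntegral.integral_smul_const,
      intervalIntegral.integral_sub (hint _) (hint _),
      integral_rpow_mul_posPow hβ (gridPt_nonneg hT hJ i) ht.1.le,
      integral_rpow_mul_posPow hβ (gridPt_nonneg hT hJ (i + 1)) ht.1.le, smul_smul, hΓ]
    congr 1
    have := (Real.Gamma_pos_of_pos hβ).ne'
    field_simp
  · exact ((hint _).sub (hint _)).smul_continuousOn continuousOn_const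

theorem HasSteps.isLeftRLDeriv (hT : 0 < T) (hJ : 0 < J) {W : ℝ → E} {w : ℕ → E}
    (h : HasSteps T J W w) {α : ℝ} (hα : α < 1) :
    IsLeftRLDeriv T α W (stepRLDeriv T J (1 - α) w) := by
  have hβ : 0 < 1 - α := by linarith
  have key := isWeakDeriv_of_hasDerivAt hT.le (countable_range (gridPt T J))
    (continuous_stepRLInt hβ w).continuousOn (fun t ht => hasDerivAt_stepRLInt w ht.2)
    (intervalIntegrable_stepRLDeriv hβ w 0 T)
  refine ⟨key.1, fun φ h1 h2 h3 => ?_⟩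
  rw [← key.2 φ h1 h2 h3]
  exact setIntegral_congr_fun measurableSet_Ioo fun t ht => by
    simp only [h.leftRLInt_eq hT hJ hβ ht]

/-- The average of the Riemann-Liouville derivative over a grid interval is a discrete
convolution. -/
theorem integral_stepRLDeriv (hT : 0 < T) (hJ : 0 < J) {β : ℝ} (hβ : 0 < β) (w : ℕ → E)
    (k : ℕ) :
    ∫ t in Ioo (gridPt T J k) (gridPt T J (k + 1)), stepRLDeriv T J β w t
      = ∑ i ∈ Finset.range J, convCoeff β (T / J) ((k : ℤ) - i) • w i := by
  have hg : ∀ i j : ℕ, gridPt T J i - gridPt T J j = (T / J) * ((i : ℝ) - j) := by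
    intro i j
    simp only [gridPt]
    ring
  rw [← integral_Ioc_eq_integral_Ioo, ← intervalIntegral.integral_of_le (gridPt_lt hT hJ k).le,
    integral_eq_of_hasDerivAt_off_countable_of_le (stepRLInt T J β w) _ (gridPt_lt hT hJ k).le
    (countable_range (gridPt T J)) (continuous_stepRLInt hβ w).continuousOn
    (fun t ht => hasDerivAt_stepRLInt w ht.2) (intervalIntegrable_stepRLDeriv hβ w _ _),
    stepRLInt, stepRLInt, ← Finset.sum_sub_distrib]
  refine Finset.sum_congr rfl fun i _ => ?_
  rw [← sub_smul, hg, hg, hg, hg, posPow_mul (step_pos hT hJ), posPow_mul (step_pos hT hJ),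
    posPow_mul (step_pos hT hJ), posPow_mul (step_pos hT hJ), convCoeff]
  push_cast
  congr 1
  rw [show (k : ℝ) + 1 - (i + 1) = k - i by ring, show (k : ℝ) + 1 - i = k - i + 1 by ring,
    show (k : ℝ) - (i + 1) = k - i - 1 by ring]
  ring

end StepRL

/-- For `β = 0` the convolution is the backward difference. -/
theorem sum_convCoeff_zero {E : Type*} [AddCommGroup E] [Module ℂ E] (τ : ℝ) {J k : ℕ}
    (hk : k < J) (w : ℕ → E) :
    ∑ i ∈ Finset.range J, (convCoeff 0 τ ((k : ℤ) - i) : ℂ) • w i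
      = w k - if k = 0 then 0 else w (k - 1) := by
  have hval : ∀ n : ℤ, posPow 0 (n : ℝ) = if 0 < n then 1 else 0 := by
    intro n
    split_ifs with h
    · rw [posPow_of_pos (by exact_mod_cast h), Real.rpow_zero]
    · exact posPow_of_nonpos (by exact_mod_cast not_lt.mp h)
  have hc : ∀ n : ℤ, convCoeff 0 τ n = if n = 0 then 1 else if n = 1 then -1 else 0 := by
    intro n
    have h1 := hval (n + 1)
    have h2 := hval n
    have h3 := hval (n - 1)
    push_cast at h1 h3
    rw [convCoeff, h1, h2, h3, Real.rpow_zero, zero_add, Real.Gamma_one]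
    split_ifs <;> first | lia | norm_num
  rw [sum_causal (fun n hn => convCoeff_neg hn) hk, hc 0]
  rcases k with _ | m
  · simp
  · rw [Finset.sum_range_succ, Finset.sum_eq_zero]
    · rw [hc]
      simp [sub_eq_add_neg]
    · intro i hi
      have := Finset.mem_range.mp hi
      rw [hc, if_neg (by lia), if_neg (by lia)]
      simp

/-! ### The discrete state equation as a convolution system -/

section State

variable {X Y : Type*}
  [NormedAddCommGroup X] [InnerProductSpace ℂ X]
  [NormedAddCommGroup Y] [InnerProductSpace ℂ Y]
  {T : ℝ} {J : ℕ}

/-- The integrals of the data `g` over the grid intervals. -/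
noncomputable def gridData (T : ℝ) (J : ℕ) (g : ℝ → (X →L⋆[ℂ] ℂ)) (k : ℕ) : X →L⋆[ℂ] ℂ :=
  ∫ t in Ioo (gridPt T J k) (gridPt T J (k + 1)), g t

theorem integrable_eval {μ : Measure ℝ} {g : ℝ → (X →L⋆[ℂ] ℂ)} (hg : Integrable g μ) (x : X) :
    Integrable (fun t => g t x) μ :=
  (ContinuousLinearMap.apply' ℂ (starRingEnd ℂ) x).integrable_comp hg

theorem HasSteps.integrableOn_pairing (hT : 0 < T) (hJ : 0 < J) {g : ℝ → (X →L⋆[ℂ] ℂ)}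
    (hg : IntegrableOn g (Ioo 0 T)) {V : ℝ → X} {v : ℕ → X} (hV : HasSteps T J V v) :
    IntegrableOn (fun t => g t (V t)) (Ioo 0 T) :=
  integrableOn_of_grid hT hJ fun k hk => IntegrableOn.congr_fun
    (integrable_eval (hg.mono_set (Ioo_gridPt_subset hT hJ hk)) (v k))
    (fun t ht => by rw [hV k hk t ht]) measurableSet_Ioo

theorem HasSteps.integral_pairing (hT : 0 < T) (hJ : 0 < J) {g : ℝ → (X →L⋆[ℂ] ℂ)}
    (hg : IntegrableOn g (Ioo 0 T)) {V : ℝ → X} {v : ℕ → X} (hV : HasSteps T J V v) :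
    ∫ t in Ioo 0 T, g t (V t) = ∑ k ∈ Finset.range J, gridData T J g k (v k) := by
  rw [integral_Ioo_eq_sum hT hJ (hV.integrableOn_pairing hT hJ hg)]
  refine Finset.sum_congr rfl fun k hk => ?_
  have hk' := Finset.mem_range.mp hk
  rw [setIntegral_congr_fun measurableSet_Ioo (g := fun t => g t (v k))
    fun t ht => by simp only [hV k hk' t ht]]
  exact (ContinuousLinearMap.apply' ℂ (starRingEnd ℂ) (v k)).integral_comp_comm
    (hg.mono_set (Ioo_gridPt_subset hT hJ hk'))

theorem forall_sum_apply_eq_iff {q r : ℕ → (X →L⋆[ℂ] ℂ)} :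
    (∀ v : ℕ → X, ∑ k ∈ Finset.range J, q k (v k) = ∑ k ∈ Finset.range J, r k (v k)) ↔
      ∀ k < J, q k = r k := by
  constructor
  · intro h k hk
    ext x
    have := h (Pi.single k x)
    rwa [Finset.sum_eq_single_of_mem k (Finset.mem_range.mpr hk),
      Finset.sum_eq_single_of_mem k (Finset.mem_range.mpr hk), Pi.single_eq_same] at this
    all_goals
      intro i _ hi
      simp [Pi.single_eq_of_ne hi]
  · intro h v
    exact Finset.sum_congr rfl fun k hk => by rw [h k (Finset.mem_range.mp hk)]

/-- Testing with all step functions amounts to testing the integrals over the grid intervals. -/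
theorem forall_Wstep_iff (hT : 0 < T) (hJ : 0 < J) {q r : ℕ → (X →L⋆[ℂ] ℂ)}
    {f f' : (ℝ → X) → ℂ}
    (hf : ∀ V v, HasSteps T J V v → f V = ∑ k ∈ Finset.range J, q k (v k))
    (hf' : ∀ V v, HasSteps T J V v → f' V = ∑ k ∈ Finset.range J, r k (v k)) :
    (∀ V ∈ Wstep T J X, f V = f' V) ↔ ∀ k < J, q k = r k := by
  rw [← forall_sum_apply_eq_iff]
  constructor
  · intro h v
    have hv := hasSteps_stepFun hT hJ v
    rw [← hf _ v hv, ← hf' _ v hv]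
    exact h _ ((mem_Wstep_iff hT hJ).mpr ⟨v, hv⟩)
  · intro h V hV
    obtain ⟨v, hv⟩ := (mem_Wstep_iff hT hJ).mp hV
    rw [hf _ v hv, hf' _ v hv, h v]

theorem integral_gridPt_const {E : Type*} [NormedAddCommGroup E] [NormedSpace ℂ E]
    [CompleteSpace E] (hT : 0 < T) (hJ : 0 < J) {W : ℝ → E} {w : ℕ → E} (hW : HasSteps T J W w)
    {k : ℕ} (hk : k < J) :
    ∫ t in Ioo (gridPt T J k) (gridPt T J (k + 1)), W t = ((T / J : ℝ) : ℂ) • w k := by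
  rw [setIntegral_congr_fun measurableSet_Ioo (g := fun _ => w k) (hW k hk), setIntegral_const,
    Real.volume_real_Ioo_of_le (gridPt_lt hT hJ k).le, gridPt_succ, add_sub_cancel_left,
    Complex.coe_smul]

variable {ι B : X →L[ℂ] Y} {W : ℝ → Y} {w : ℕ → Y} {g : ℝ → (X →L⋆[ℂ] ℂ)}

/-- For `α = 1` the jump terms are backward differences, i.e. the convolution with the
coefficients of exponent `0`. -/
theorem HasSteps.galerkin_iff_of_one (hT : 0 < T) (hJ : 0 < J) (hg : IntegrableOn g (Ioo 0 T))
    (hW : HasSteps T J W w) :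
    (∀ V ∈ Wstep T J X,
      transp ι (Function.rightLim W 0) (Function.rightLim V 0)
        + ∑ j ∈ Finset.Icc 1 (J - 1),
            transp ι (Function.rightLim W (gridPt T J j) - Function.leftLim W (gridPt T J j))
              (Function.rightLim V (gridPt T J j))
        - ∫ t in Ioo 0 T, transp B (W t) (V t)
        = ∫ t in Ioo 0 T, (g t) (V t)) ↔
      IsConvSol ι B (convCoeff 0 (T / J)) (T / J) J (gridData T J g) w := by
  have hI : IntegrableOn (fun t => transp B (W t)) (Ioo 0 T) :=
    (transp B).integrable_comp (hW.integrableOn hT hJ)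
  refine forall_Wstep_iff hT hJ (fun V v hV => ?_)
    (fun V v hV => hV.integral_pairing hT hJ hg)
  rw [hW.rightLim_zero hT hJ, hV.rightLim_zero hT hJ, hV.integral_pairing hT hJ hI]
  simp only [sub_apply, Finset.sum_sub_distrib]
  congr 1
  · obtain ⟨m, rfl⟩ : ∃ m, J = m + 1 := ⟨J - 1, by lia⟩
    rw [Finset.sum_range_succ', add_comm, Nat.add_sub_cancel, sum_convCoeff_zero _ hJ,
      Finset.range_eq_Ico, Finset.sum_Ico_add' (fun k : ℕ => (transp ι (∑ i ∈ Finset.range (m + 1),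
        (convCoeff 0 (T / (m + 1 : ℕ)) ((k : ℤ) - i) : ℂ) • w i)) (v k)) 0 m 1]
    simp only [zero_add, if_true, sub_zero]
    congr 1
    refine Finset.sum_congr rfl fun j hj => ?_
    obtain ⟨h1, h2⟩ := Finset.mem_Icc.mp hj
    have h3 := hW.leftLim_eq hT hJ (k := j - 1) (by lia)
    rw [Nat.sub_add_cancel h1] at h3
    rw [sum_convCoeff_zero _ (by lia), if_neg (by lia), h3, hW.rightLim_eq hT hJ (by lia),
      hV.rightLim_eq hT hJ (by lia)]
  · refine Finset.sum_congr rfl fun k hk => ?_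
    rw [gridData, integral_gridPt_const hT hJ (hW.comp _) (Finset.mem_range.mp hk)]

variable [CompleteSpace Y]

/-- For `α < 1` the Galerkin equations are a convolution system; the weak derivative may be taken
to be the explicit one, as it is unique almost everywhere. -/
theorem HasSteps.galerkin_iff_of_lt (hT : 0 < T) (hJ : 0 < J) (hg : IntegrableOn g (Ioo 0 T))
    {α : ℝ} (hα : α < 1) (hW : HasSteps T J W w) :
    (∃ D : ℝ → Y, IsLeftRLDeriv T α W D ∧ ∀ V ∈ Wstep T J X,
      ∫ t in Ioo 0 T, (transp ι (D t) - transp B (W t)) (V t)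
        = ∫ t in Ioo 0 T, (g t) (V t)) ↔
      IsConvSol ι B (convCoeff (1 - α) (T / J)) (T / J) J (gridData T J g) w := by
  set D₀ := stepRLDeriv T J (1 - α) w with hD₀
  have h0 : IsLeftRLDeriv T α W D₀ := hW.isLeftRLDeriv hT hJ hα
  have key : (∃ D : ℝ → Y, IsLeftRLDeriv T α W D ∧ ∀ V ∈ Wstep T J X,
      ∫ t in Ioo 0 T, (transp ι (D t) - transp B (W t)) (V t)
        = ∫ t in Ioo 0 T, (g t) (V t)) ↔ ∀ V ∈ Wstep T J X,
      ∫ t in Ioo 0 T, (transp ι (D₀ t) - transp B (W t)) (V t)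
        = ∫ t in Ioo 0 T, (g t) (V t) := by
    refine ⟨?_, fun h => ⟨D₀, h0, h⟩⟩
    rintro ⟨D, hD, h⟩ V hV
    rw [← h V hV]
    refine integral_congr_ae ?_
    filter_upwards [IsWeakDeriv.ae_eq h0 hD fun _ _ => rfl] with t ht
    rw [ht]
  have hI : IntegrableOn (fun t => transp ι (D₀ t) - transp B (W t)) (Ioo 0 T) :=
    ((transp ι).integrable_comp h0.1).sub ((transp B).integrable_comp (hW.integrableOn hT hJ))
  rw [key, forall_Wstep_iff hT hJ (fun V v hV => hV.integral_pairing hT hJ hI)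
    (fun V v hV => hV.integral_pairing hT hJ hg), IsConvSol]
  refine forall₂_congr fun k hk => ?_
  have hsub := Ioo_gridPt_subset hT hJ hk
  have e : gridData T J (fun t => transp ι (D₀ t) - transp B (W t)) k
      = transp ι (∑ i ∈ Finset.range J, (convCoeff (1 - α) (T / J) ((k : ℤ) - i) : ℂ) • w i)
        - ((T / J : ℝ) : ℂ) • transp B (w k) := by
    rw [gridData, integral_sub ((transp ι).integrable_comp (IntegrableOn.mono_set h0.1 hsub))
      ((transp B).integrable_comp ((hW.integrableOn hT hJ).mono_set hsub)),
      (transp ι).integral_comp_comm (IntegrableOn.mono_set h0.1 hsub),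
      integral_stepRLDeriv hT hJ (by linarith), integral_gridPt_const hT hJ (hW.comp _) hk]
    simp_rw [← Complex.coe_smul]
  rw [e]

theorem isDiscreteState_iff (hT : 0 < T) (hJ : 0 < J) (hg : IntegrableOn g (Ioo 0 T))
    {α : ℝ} (hα : α ≤ 1) :
    IsDiscreteState ι B α T J g W ↔ ∃ w, HasSteps T J W w ∧
      IsConvSol ι B (convCoeff (1 - α) (T / J)) (T / J) J (gridData T J g) w := by
  have h : ∀ w, HasSteps T J W w → (IsDiscreteState ι B α T J g W ↔
      IsConvSol ι B (convCoeff (1 - α) (T / J)) (T / J) J (gridData T J g) w) := by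
    intro w hW
    have hmem : W ∈ Wstep T J Y := (mem_Wstep_iff hT hJ).mpr ⟨w, hW⟩
    rcases hα.lt_or_eq with h1 | rfl
    · rw [← hW.galerkin_iff_of_lt hT hJ hg h1]
      exact ⟨fun h => h.2.1 h1, fun h => ⟨hmem, fun _ => h, fun h' => absurd h' h1.ne⟩⟩
    · rw [sub_self, ← hW.galerkin_iff_of_one hT hJ hg]
      exact ⟨fun h => h.2.2 rfl, fun h => ⟨hmem, fun h' => absurd h' (lt_irrefl _), fun _ => h⟩⟩
  constructor
  · intro hs
    obtain ⟨w, hW⟩ := (mem_Wstep_iff hT hJ).mp hs.1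
    exact ⟨w, hW, (h w hW).mp hs⟩
  · rintro ⟨w, hW, hc⟩
    exact (h w hW).mpr hc

end State

/-! ### Time reversal and the discrete adjoint equation -/

section Reflection

theorem setIntegral_Ioo_reflect {E : Type*} [NormedAddCommGroup E] [NormedSpace ℝ E] {T : ℝ}
    (a b : ℝ) (f : ℝ → E) :
    ∫ t in Ioo a b, f (T - t) = ∫ t in Ioo (T - b) (T - a), f t := by
  rcases le_or_gt a b with h | h
  · rw [← integral_Ioc_eq_integral_Ioo, ← integral_Ioc_eq_integral_Ioo,
      ← intervalIntegral.integral_of_le h, ← intervalIntegral.integral_of_le (by linarith),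
      intervalIntegral.integral_comp_sub_left]
  · simp [Ioo_eq_empty h.le.not_gt, Ioo_eq_empty (show ¬ T - b < T - a by linarith)]

theorem integrableOn_Ioo_reflect {E : Type*} [NormedAddCommGroup E] {T : ℝ} (hT : 0 < T)
    {f : ℝ → E} (hf : IntegrableOn f (Ioo 0 T)) : IntegrableOn (fun t => f (T - t)) (Ioo 0 T) := by
  have h := ((intervalIntegrable_iff_integrableOn_Ioo_of_le hT.le).mpr hf).comp_sub_left T
  rw [sub_zero, sub_self] at h
  exact (intervalIntegrable_iff_integrableOn_Ioo_of_le hT.le).mp h.symm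

section Deriv

variable {E : Type*} [NormedAddCommGroup E] [NormedSpace ℝ E]

theorem rightRLInt_eq_leftRLInt_reflect (T γ : ℝ) (v : ℝ → E) (t : ℝ) :
    rightRLInt T γ v (T - t) = leftRLInt γ (fun s => v (T - s)) t := by
  rw [rightRLInt, leftRLInt]
  have h := intervalIntegral.integral_comp_sub_left (a := 0) (b := t)
    (fun s => (s - (T - t)) ^ (γ - 1) • v s) T
  rw [sub_zero] at h
  rw [← h]
  simp only [sub_sub_sub_cancel_left]

theorem IsWeakDeriv.reflect {T : ℝ} (hT : 0 < T) {v d : ℝ → E} (h : IsWeakDeriv T v d) :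
    IsWeakDeriv T (fun t => v (T - t)) (fun t => - d (T - t)) := by
  refine ⟨(integrableOn_Ioo_reflect hT h.1).neg, fun φ hφ hc hs => ?_⟩
  let e : ℝ ≃ₜ ℝ := Homeomorph.subLeft T
  have hsupp : tsupport (φ ∘ e) = e ⁻¹' tsupport φ := tsupport_comp_eq_preimage φ e
  have key := h.2 (φ ∘ e) (hφ.comp (contDiff_const.sub contDiff_id)) (hc.comp_homeomorph e) <| by
    rw [hsupp]
    intro t ht
    have := hs ht
    simp only [e, Homeomorph.coe_subLeft, mem_Ioo] at this
    exact ⟨by linarith [this.2], by linarith [this.1]⟩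
  have hd : deriv (φ ∘ e) = fun t => - deriv φ (T - t) :=
    funext fun t => deriv_comp_const_sub φ T t
  rw [hd] at key
  simp only [Function.comp_apply, e, Homeomorph.coe_subLeft, neg_smul] at key
  have e1 := setIntegral_Ioo_reflect (T := T) 0 T (fun t => deriv φ (T - t) • v t)
  have e2 := setIntegral_Ioo_reflect (T := T) 0 T (fun t => φ (T - t) • d t)
  simp only [sub_sub_cancel, sub_self, sub_zero] at e1 e2
  rw [e1]
  simp only [smul_neg]
  rw [integral_neg] at key ⊢
  rw [e2, neg_neg]
  exact neg_inj.mp key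

theorem isRightRLDeriv_iff_reflect {T α : ℝ} (hT : 0 < T) {v d : ℝ → E} :
    IsRightRLDeriv T α v d ↔ IsLeftRLDeriv T α (fun t => v (T - t)) (fun t => d (T - t)) := by
  constructor
  · intro h
    have := IsWeakDeriv.reflect hT h
    simpa only [IsLeftRLDeriv, rightRLInt_eq_leftRLInt_reflect, neg_neg] using this
  · intro h
    have := IsWeakDeriv.reflect hT h
    simpa only [IsRightRLDeriv, ← rightRLInt_eq_leftRLInt_reflect, sub_sub_cancel] using this

end Deriv

variable {T : ℝ} {J : ℕ}

theorem sub_gridPt (hJ : 0 < J) {k : ℕ} (hk : k ≤ J) :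
    T - gridPt T J k = gridPt T J (J - k) := by
  have h : (J : ℝ) * (T / J) = T := gridPt_self hJ
  simp only [gridPt, Nat.cast_sub hk]
  linarith

theorem HasSteps.reflect {E : Type*} (hJ : 0 < J) {W : ℝ → E} {w : ℕ → E}
    (h : HasSteps T J W w) : HasSteps T J (fun t => W (T - t)) (fun k => w (J - 1 - k)) := by
  intro k hk t ht
  refine h (J - 1 - k) (by lia) (T - t) ?_
  have h1 := sub_gridPt (T := T) hJ hk.le
  have h2 := sub_gridPt (T := T) hJ (Nat.succ_le_of_lt hk)
  rw [show J - 1 - k + 1 = J - k by lia, show J - 1 - k = J - (k + 1) by lia, ← h1, ← h2]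
  exact ⟨by linarith [ht.2], by linarith [ht.1]⟩

theorem forall_Wstep_reflect {E : Type*} (hT : 0 < T) (hJ : 0 < J) {p : (ℝ → E) → Prop} :
    (∀ V ∈ Wstep T J E, p V) ↔ ∀ V ∈ Wstep T J E, p (fun t => V (T - t)) := by
  have hmem : ∀ V ∈ Wstep T J E, (fun t => V (T - t)) ∈ Wstep T J E := by
    intro V hV
    obtain ⟨v, hv⟩ := (mem_Wstep_iff hT hJ).mp hV
    exact (mem_Wstep_iff hT hJ).mpr ⟨_, hv.reflect hJ⟩
  refine ⟨fun h V hV => h _ (hmem V hV), fun h V hV => ?_⟩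
  simpa only [sub_sub_cancel] using h _ (hmem V hV)

variable {X Y : Type*}
  [NormedAddCommGroup X] [InnerProductSpace ℂ X]
  [NormedAddCommGroup Y] [InnerProductSpace ℂ Y]

theorem gridData_reflect (hJ : 0 < J) (g : ℝ → (X →L⋆[ℂ] ℂ)) {k : ℕ} (hk : k < J) :
    gridData T J (fun t => g (T - t)) k = gridData T J g (J - 1 - k) := by
  rw [gridData, setIntegral_Ioo_reflect, sub_gridPt hJ hk.le,
    sub_gridPt hJ (Nat.succ_le_of_lt hk), gridData, show J - 1 - k + 1 = J - k by lia,
    show J - (k + 1) = J - 1 - k by lia]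

/-- Time reversal turns the discrete adjoint equation for `A` into a discrete state equation. -/
theorem isDiscreteAdjoint_iff_reflect (hT : 0 < T) (hJ : 0 < J) {ι A : X →L[ℂ] Y} {α : ℝ}
    {g : ℝ → (X →L⋆[ℂ] ℂ)} {W : ℝ → Y} :
    IsDiscreteAdjoint ι A α T J g W ↔
      IsDiscreteState ι A α T J (fun t => g (T - t)) (fun t => W (T - t)) := by
  have hmem : W ∈ Wstep T J Y ↔ (fun t => W (T - t)) ∈ Wstep T J Y := by
    constructor <;> intro h <;> obtain ⟨w, hw⟩ := (mem_Wstep_iff hT hJ).mp h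
    · exact (mem_Wstep_iff hT hJ).mpr ⟨_, hw.reflect hJ⟩
    · have := hw.reflect hJ
      simp only [sub_sub_cancel] at this
      exact (mem_Wstep_iff hT hJ).mpr ⟨_, this⟩
  have hint : ∀ f : ℝ → ℂ, ∫ t in Ioo 0 T, f (T - t) = ∫ t in Ioo 0 T, f t := by
    intro f
    rw [setIntegral_Ioo_reflect, sub_self, sub_zero]
  rw [IsDiscreteAdjoint, IsDiscreteState, ← hmem]
  refine and_congr_right fun hW => and_congr (forall_congr' fun hα => ?_)
    (forall_congr' fun hα => ?_)
  · constructor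
    · rintro ⟨D, hD, h⟩
      refine ⟨_, (isRightRLDeriv_iff_reflect hT).mp hD, ?_⟩
      refine (forall_Wstep_reflect hT hJ).mpr fun V hV => ?_
      have h1 := hint fun t => (transp ι (D t) - transp A (W t)) (V t)
      have h2 := hint fun t => g t (V t)
      rw [h1, h2]
      exact h V hV
    · rintro ⟨D, hD, h⟩
      refine ⟨fun t => D (T - t), (isRightRLDeriv_iff_reflect hT).mpr
        (by simpa only [sub_sub_cancel] using hD), fun V hV => ?_⟩
      have h3 := (forall_Wstep_reflect hT hJ).mp h V hV
      have h1 := hint fun t => (transp ι (D (T - t)) - transp A (W t)) (V t)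
      have h2 := hint fun t => g t (V t)
      simp only [sub_sub_cancel] at h1
      rw [← h1, ← h2]
      exact h3
  · rw [forall_Wstep_reflect hT hJ]
    refine forall₂_congr fun V hV => ?_
    obtain ⟨w, hw⟩ := (mem_Wstep_iff hT hJ).mp hW
    obtain ⟨v, hv⟩ := (mem_Wstep_iff hT hJ).mp hV
    have hw' := hw.reflect hJ
    have hv' := hv.reflect hJ
    have h1 := hint fun t => transp A (W t) (V (T - t))
    have h2 := hint fun t => g t (V (T - t))
    simp only [sub_sub_cancel] at h1 h2
    rw [← h1, ← h2, hw.leftLim_last hT hJ, hv'.leftLim_last hT hJ, hw'.rightLim_zero hT hJ,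
      hv.rightLim_zero hT hJ, Nat.sub_zero, Nat.sub_self]
    congr! 3
    refine Finset.sum_nbij' (fun j => J - j) (fun j => J - j) ?_ ?_ ?_ ?_ fun j hj => ?_
    iterate 4
      intro j hj
      simp only [Finset.mem_Icc] at hj ⊢
      lia
    obtain ⟨hj1, hj2⟩ := Finset.mem_Icc.mp hj
    have l1 := hw.leftLim_eq hT hJ (k := j - 1) (by lia)
    have l2 := hv'.leftLim_eq hT hJ (k := j - 1) (by lia)
    have l3 := hw'.leftLim_eq hT hJ (k := J - j - 1) (by lia)
    rw [Nat.sub_add_cancel hj1] at l1 l2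
    rw [Nat.sub_add_cancel (by lia)] at l3
    rw [l1, l2, l3, hw.rightLim_eq hT hJ (by lia), hw'.rightLim_eq hT hJ (by lia),
      hv.rightLim_eq hT hJ (by lia), show J - 1 - (j - 1) = J - j by lia,
      show J - 1 - (J - j) = j - 1 by lia, show J - 1 - (J - j - 1) = j by lia]

/-- The discrete adjoint equation as a convolution system, the sequence `w` running backwards in
time. -/
theorem isDiscreteAdjoint_iff [CompleteSpace Y] (hT : 0 < T) (hJ : 0 < J) {ι A : X →L[ℂ] Y}
    {α : ℝ} (hα : α ≤ 1) {g : ℝ → (X →L⋆[ℂ] ℂ)} (hg : IntegrableOn g (Ioo 0 T)) {W : ℝ → Y} :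
    IsDiscreteAdjoint ι A α T J g W ↔ ∃ w, HasSteps T J W (fun k => w (J - 1 - k)) ∧
      IsConvSol ι A (convCoeff (1 - α) (T / J)) (T / J) J
        (fun k => gridData T J g (J - 1 - k)) w := by
  rw [isDiscreteAdjoint_iff_reflect hT hJ,
    isDiscreteState_iff hT hJ (integrableOn_Ioo_reflect hT hg) hα]
  refine exists_congr fun w => and_congr ⟨fun h => ?_, fun h => ?_⟩ ?_
  · simpa only [sub_sub_cancel] using h.reflect hJ
  · intro k hk t ht
    have h1 : W (T - t) = w (J - 1 - (J - 1 - k)) := h.reflect hJ k hk t ht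
    rwa [show J - 1 - (J - 1 - k) = k by lia] at h1
  · exact forall₂_congr fun k hk => by rw [gridData_reflect hJ g hk]

end Reflection

/-! ### The reduced minimisation problem -/

section Minimisation

variable {H Y : Type*} [NormedAddCommGroup H] [InnerProductSpace ℂ H]
  [NormedAddCommGroup Y] [InnerProductSpace ℂ Y]

/-- Exact second-order expansion of the quadratic tracking functional at `U`. -/
theorem tracking_expand (L : H →L[ℂ] Y) (yd : Y) (ν : ℝ) (U V : H) :
    1 / 2 * ‖L V - yd‖ ^ 2 + ν / 2 * ‖V‖ ^ 2
      = 1 / 2 * ‖L U - yd‖ ^ 2 + ν / 2 * ‖U‖ ^ 2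
        + (inner ℂ (L (V - U)) (L U - yd) + (ν : ℂ) * inner ℂ (V - U) U).re
        + (1 / 2 * ‖L (V - U)‖ ^ 2 + ν / 2 * ‖V - U‖ ^ 2) := by
  have h1 := norm_add_sq (𝕜 := ℂ) (L (V - U)) (L U - yd)
  have h2 := norm_add_sq (𝕜 := ℂ) (V - U) U
  rw [map_sub, sub_add_sub_cancel] at h1
  rw [sub_add_cancel] at h2
  rw [map_sub, h1, h2, Complex.add_re, Complex.re_ofReal_mul]
  simp only [RCLike.re_to_complex]
  ring

variable [CompleteSpace H] [CompleteSpace Y]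

/-- The variational inequality for a quadratic tracking functional. The minimiser is the
projection of `(yd, 0)` onto the image of `K` under `u ↦ (L u, √ν u)`, which is a closed
embedding into the Hilbert sum `Y ⊕ H`. -/
theorem exists_variational_inequality (L : H →L[ℂ] Y) (yd : Y) {ν : ℝ} (hν : 0 < ν) {K : Set H}
    (hne : K.Nonempty) (hconv : Convex ℝ K) (hcl : IsClosed K) :
    ∃ U ∈ K, ∀ V ∈ K, 0 ≤ (inner ℂ (L (V - U)) (L U - yd) + (ν : ℂ) * inner ℂ (V - U) U).re := by
  let E := WithLp 2 (Y × H)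
  let G : H →L[ℂ] E := (WithLp.prodContinuousLinearEquiv 2 ℂ Y H).symm.toContinuousLinearMap.comp
    (L.prod (((√ν : ℝ) : ℂ) • ContinuousLinearMap.id ℂ H))
  have hG1 : ∀ u, (G u).fst = L u := fun u => rfl
  have hG2 : ∀ u, (G u).snd = ((√ν : ℝ) : ℂ) • u := fun u => rfl
  have hνs : 0 < √ν := Real.sqrt_pos.mpr hν
  have hanti : AntilipschitzWith (Real.toNNReal (√ν)⁻¹) G := by
    refine AddMonoidHomClass.antilipschitz_of_bound G fun u => ?_
    have h1 : ‖(G u).snd‖ ≤ ‖G u‖ := WithLp.norm_snd_le _ (G u)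
    rw [hG2, norm_smul, Complex.norm_real, Real.norm_of_nonneg hνs.le] at h1
    rw [Real.coe_toNNReal _ (inv_nonneg.mpr hνs.le), inv_mul_eq_div, le_div_iff₀ hνs, mul_comm]
    exact h1
  have hcomplete : IsComplete (G '' K) :=
    ((hanti.isClosedEmbedding G.uniformContinuous).isClosedMap K hcl).isComplete
  let _ : InnerProductSpace ℝ E := InnerProductSpace.complexToReal
  have hconvG : Convex ℝ (G '' K) := hconv.linear_image (G.toLinearMap.restrictScalars ℝ)
  let u₀ : E := WithLp.toLp 2 (yd, 0)
  obtain ⟨_, ⟨U, hU, rfl⟩, hmin⟩ :=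
    exists_norm_eq_iInf_of_complete_convex (hne.image G) hcomplete hconvG u₀
  refine ⟨U, hU, fun V hV => ?_⟩
  have h := (norm_eq_iInf_iff_real_inner_le_zero hconvG ⟨U, hU, rfl⟩).mp hmin (G V) ⟨V, hV, rfl⟩
  have h1 : (inner ℂ (u₀ - G U) (G V - G U)).re ≤ 0 := h
  have h2 : inner ℂ (u₀ - G U) (G V - G U) = inner ℂ (yd - L U) (L V - L U)
      + inner ℂ (0 - ((√ν : ℝ) : ℂ) • U) (((√ν : ℝ) : ℂ) • V - ((√ν : ℝ) : ℂ) • U) :=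
    WithLp.prod_inner_apply _ _
  rw [h2, zero_sub, inner_neg_left, ← smul_sub, inner_smul_left, inner_smul_right,
    Complex.conj_ofReal, ← mul_assoc, ← Complex.ofReal_mul, Real.mul_self_sqrt hν.le,
    ← neg_sub (L U) yd, inner_neg_left, ← map_sub, Complex.add_re, Complex.neg_re,
    Complex.neg_re, Complex.re_ofReal_mul] at h1
  have h3 := inner_re_symm (𝕜 := ℂ) (L (V - U)) (L U - yd)
  have h4 := inner_re_symm (𝕜 := ℂ) (V - U) U
  simp only [RCLike.re_to_complex] at h3 h4
  rw [Complex.add_re, Complex.re_ofReal_mul, h3, h4]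
  linarith

end Minimisation

section Control

variable {X Y Z : Type*}
  [NormedAddCommGroup X] [InnerProductSpace ℂ X]
  [NormedAddCommGroup Y] [InnerProductSpace ℂ Y]
  [NormedAddCommGroup Z] [InnerProductSpace ℂ Z]
  {T : ℝ} {J : ℕ}

theorem integrableOn_applyControl (R : Z →L[ℂ] (X →L⋆[ℂ] ℂ)) (u : L2 T Z) :
    IntegrableOn (applyControl (R : Z →ₗ[ℂ] (X →L⋆[ℂ] ℂ)) u) (Ioo 0 T) :=
  R.integrable_comp ((Lp.memLp u).integrable (by norm_num))

variable [CompleteSpace Z]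

/-- Integration over a measurable set is a bounded operator on `L²` of a finite measure. -/
theorem exists_setIntegral_clm (s : Set ℝ) (hs : MeasurableSet s) :
    ∃ I : L2 T Z →L[ℂ] Z, ∀ u : L2 T Z, I u = ∫ t in s, u t ∂(volume.restrict (Ioo 0 T)) := by
  have hint : ∀ u : L2 T Z, Integrable u ((volume.restrict (Ioo 0 T)).restrict s) := fun u =>
    ((Lp.memLp u).integrable (by norm_num)).mono_measure Measure.restrict_le_self
  refine ⟨LinearMap.mkContinuous
    { toFun := fun u => ∫ t in s, u t ∂(volume.restrict (Ioo 0 T))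
      map_add' := fun u v => ?_
      map_smul' := fun c u => ?_ }
    ((volume.restrict (Ioo 0 T)).real s ^ (1 / (2 : ENNReal).toReal)) fun u => ?_, fun u => rfl⟩
  · rw [← integral_add (hint u) (hint v)]
    exact integral_congr_ae (ae_restrict_of_ae (Lp.coeFn_add u v))
  · rw [RingHom.id_apply, ← integral_smul]
    exact integral_congr_ae (ae_restrict_of_ae (Lp.coeFn_smul c u))
  · set c := ∫ t in s, u t ∂(volume.restrict (Ioo 0 T)) with hc
    change ‖c‖ ≤ _
    have h1 := L2.inner_indicatorConstLp_eq_inner_setIntegral ℂ hs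
      (measure_ne_top (volume.restrict (Ioo 0 T)) s) c u
    have h2 := norm_inner_le_norm (𝕜 := ℂ) (indicatorConstLp 2 hs
      (measure_ne_top (volume.restrict (Ioo 0 T)) s) c) u
    rw [h1, ← hc, inner_self_eq_norm_sq_to_K, norm_indicatorConstLp (by norm_num) (by norm_num)]
      at h2
    rcases (norm_nonneg c).eq_or_lt with h0 | h0
    · rw [← h0]; positivity
    · refine le_of_mul_le_mul_left ?_ h0
      simp only [norm_pow, RCLike.norm_ofReal, abs_norm] at h2
      linarith [h2, sq ‖c‖, mul_assoc ‖c‖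
        ((volume.restrict (Ioo 0 T)).real s ^ (1 / (2 : ENNReal).toReal)) ‖u‖]

theorem exists_gridData_clm (hT : 0 < T) (hJ : 0 < J) (R : Z →L[ℂ] (X →L⋆[ℂ] ℂ)) {k : ℕ}
    (hk : k < J) :
    ∃ Q : L2 T Z →L[ℂ] (X →L⋆[ℂ] ℂ), ∀ u : L2 T Z,
      Q u = gridData T J (applyControl (R : Z →ₗ[ℂ] (X →L⋆[ℂ] ℂ)) u) k := by
  obtain ⟨I, hI⟩ := exists_setIntegral_clm (T := T) (Z := Z)
    (Ioo (gridPt T J k) (gridPt T J (k + 1))) measurableSet_Ioo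
  refine ⟨R.comp I, fun u => ?_⟩
  have hsub := Ioo_gridPt_subset hT hJ hk
  have hu : Integrable u (volume.restrict (Ioo 0 T)) := (Lp.memLp u).integrable (by norm_num)
  rw [ContinuousLinearMap.comp_apply, hI, Measure.restrict_restrict_of_subset hsub]
  exact (R.integral_comp_comm (IntegrableOn.mono_set hu hsub)).symm

end Control

/-! ### Solution operators and the discrete Dirac mass -/

section Solution

variable {X Y : Type*}
  [NormedAddCommGroup X] [InnerProductSpace ℂ X]
  [NormedAddCommGroup Y] [InnerProductSpace ℂ Y]
  {T : ℝ} {J : ℕ}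

theorem hasSteps_deltaHat (hT : 0 < T) (hJ : 0 < J) :
    HasSteps T J (deltaHat T J) (fun k => if k = J - 1 then (T / J)⁻¹ else 0) := by
  intro k hk t ht
  have h1 : T - T / J = gridPt T J (J - 1) := by
    have := gridPt_succ (T := T) (J := J) (J - 1)
    rw [Nat.sub_add_cancel hJ, gridPt_self hJ] at this
    linarith
  have h2 : t < T := ht.2.trans_le (gridPt_le hT hJ hk)
  rw [deltaHat, h1]
  by_cases h : k = J - 1
  · simp only [h, if_true]
    exact if_pos ⟨h ▸ ht.1, h2⟩
  · have := gridPt_mono hT hJ (show k + 1 ≤ J - 1 by lia)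
    simp only [h, if_false]
    exact if_neg fun h' => by linarith [h'.1, ht.2]

theorem gridData_deltaHat [CompleteSpace Y] (hT : 0 < T) (hJ : 0 < J) (ι : X →L[ℂ] Y) (y : Y)
    {k : ℕ} (hk : k < J) :
    gridData T J (fun t => transp ι (deltaHat T J t • y)) k
      = transp ι (if k = J - 1 then y else 0) := by
  have h := (hasSteps_deltaHat hT hJ).comp (fun c => transp ι (c • y))
  rw [gridData, integral_gridPt_const hT hJ h hk]
  split_ifs
  · rw [← map_smul, Complex.coe_smul, smul_smul, mul_inv_cancel₀ (step_pos hT hJ).ne', one_smul]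
  · simp

variable [CompleteSpace Y]

/-- The solution operators `S k` of a convolution system represent `discreteState`. -/
theorem discreteState_spec (hT : 0 < T) (hJ : 0 < J) {ι B : X →L[ℂ] Y} {α : ℝ} (hα : α ≤ 1)
    {S : ℕ → ((ℕ → (X →L⋆[ℂ] ℂ)) →L[ℂ] Y)}
    (hS : ∀ q, IsConvSol ι B (convCoeff (1 - α) (T / J)) (T / J) J q (fun k => S k q) ∧
      ∀ w, IsConvSol ι B (convCoeff (1 - α) (T / J)) (T / J) J q w → ∀ k < J, w k = S k q)
    {g : ℝ → (X →L⋆[ℂ] ℂ)} (hg : IntegrableOn g (Ioo 0 T)) :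
    IsDiscreteState ι B α T J g (discreteState ι B α T J g) ∧
      ∀ W, IsDiscreteState ι B α T J g W → HasSteps T J W (fun k => S k (gridData T J g)) := by
  constructor
  · exact Classical.epsilon_spec (p := IsDiscreteState ι B α T J g)
      ⟨_, (isDiscreteState_iff hT hJ hg hα).mpr ⟨_, hasSteps_stepFun hT hJ _, (hS _).1⟩⟩
  · intro W hW
    obtain ⟨w, hw, hc⟩ := (isDiscreteState_iff hT hJ hg hα).mp hW
    intro k hk t ht
    rw [hw k hk t ht, (hS _).2 w hc k hk]

/-- The solution operators of a convolution system, applied backwards in time, represent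
`discreteAdjoint`. -/
theorem discreteAdjoint_spec (hT : 0 < T) (hJ : 0 < J) {ι B : X →L[ℂ] Y} {α : ℝ} (hα : α ≤ 1)
    {S : ℕ → ((ℕ → (X →L⋆[ℂ] ℂ)) →L[ℂ] Y)}
    (hS : ∀ q, IsConvSol ι B (convCoeff (1 - α) (T / J)) (T / J) J q (fun k => S k q) ∧
      ∀ w, IsConvSol ι B (convCoeff (1 - α) (T / J)) (T / J) J q w → ∀ k < J, w k = S k q)
    {g : ℝ → (X →L⋆[ℂ] ℂ)} (hg : IntegrableOn g (Ioo 0 T)) :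
    IsDiscreteAdjoint ι B α T J g (discreteAdjoint ι B α T J g) ∧
      ∀ W, IsDiscreteAdjoint ι B α T J g W → HasSteps T J W
        (fun k => S (J - 1 - k) (fun i => gridData T J g (J - 1 - i))) := by
  constructor
  · exact Classical.epsilon_spec (p := IsDiscreteAdjoint ι B α T J g)
      ⟨stepFun T J (fun k => S (J - 1 - k) (fun i => gridData T J g (J - 1 - i))),
        (isDiscreteAdjoint_iff hT hJ hα hg).mpr ⟨_, hasSteps_stepFun hT hJ _, (hS _).1⟩⟩
  · intro W hW
    obtain ⟨w, hw, hc⟩ := (isDiscreteAdjoint_iff hT hJ hα hg).mp hW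
    intro k hk t ht
    exact (hw k hk t ht).trans ((hS _).2 w hc (J - 1 - k) (by lia))

end Solution

end FracControl

/-! ### Well-posedness and the optimality system -/

open FracControl
theorem mainTheorem4
    {X Y Z : Type*}
    [NormedAddCommGroup X] [InnerProductSpace ℂ X] [CompleteSpace X]
    [TopologicalSpace.SeparableSpace X]
    [NormedAddCommGroup Y] [InnerProductSpace ℂ Y] [CompleteSpace Y]
    [TopologicalSpace.SeparableSpace Y]
    [NormedAddCommGroup Z] [InnerProductSpace ℂ Z] [CompleteSpace Z]
    -- the continuous dense embedding of X into Y and the operators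
    (ι : X →L[ℂ] Y) (hι : Function.Injective ι) (hιd : DenseRange ι)
    (A Astar : X →L[ℂ] Y) (ω₀ c₀ c₁ M₀ : ℝ)
    (hA : IsSectorialPair ι A Astar ω₀ c₀ c₁ M₀)
    (α : ℝ) (hα0 : 0 < α) (hα1 : α ≤ 1)
    (T : ℝ) (hT : 0 < T) (J : ℕ) (hJ : 1 < J)
    (θ₀ : ℝ) (hθ0 : 0 < θ₀) (hθ1 : θ₀ ≤ 1)
    (R : Z →ₗ[ℂ] (X →L⋆[ℂ] ℂ)) (hR : IsBoundedIntoInterp ι θ₀ R)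
    (yd : Y) (ν : ℝ) (hν : 0 < ν)
    (Uad : Set (L2 T Z)) (hUne : Uad.Nonempty) (hUconv : Convex ℝ Uad)
    (hUbdd : Bornology.IsBounded Uad) (hUclosed : IsClosed Uad)
    (hUinf : ∀ u ∈ Uad, MemLp u ⊤ (volume.restrict (Ioo 0 T))) :
    -- the discrete operators are well defined
    (∀ g : ℝ → (X →L⋆[ℂ] ℂ), IntegrableOn g (Ioo 0 T) →
      IsDiscreteState ι Astar α T J g (discreteState ι Astar α T J g) ∧
      ∀ W, IsDiscreteState ι Astar α T J g W →
        W =ᵐ[volume.restrict (Ioo 0 T)] discreteState ι Astar α T J g) ∧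
    (∀ g : ℝ → (X →L⋆[ℂ] ℂ), IntegrableOn g (Ioo 0 T) →
      IsDiscreteAdjoint ι A α T J g (discreteAdjoint ι A α T J g) ∧
      ∀ W, IsDiscreteAdjoint ι A α T J g W →
        W =ᵐ[volume.restrict (Ioo 0 T)] discreteAdjoint ι A α T J g) ∧
    (∀ u : L2 T Z, IntegrableOn (applyControl R u) (Ioo 0 T)) ∧
    (∀ v : X, ∀ w : Z, inner ℂ w (controlAdjoint R v) = starRingEnd ℂ (R w v)) ∧
    -- unique solution of the discrete problem and its optimality system
    ∃ U ∈ Uad,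
      (∀ V ∈ Uad, discreteCost ι Astar R α T J yd ν U ≤ discreteCost ι Astar R α T J yd ν V) ∧
      (∀ U' ∈ Uad, (∀ V ∈ Uad,
        discreteCost ι Astar R α T J yd ν U' ≤ discreteCost ι Astar R α T J yd ν V) → U' = U) ∧
      ∃ Yb P : ℝ → Y,
        Yb = discreteState ι Astar α T J (applyControl R U) ∧
        P = discreteAdjoint ι A α T J
          (fun t => transp ι (deltaHat T J t • (Function.leftLim Yb T - yd))) ∧
        ∃ p ∈ Wstep T J X, (∀ᵐ t ∂(volume.restrict (Ioo 0 T)), ι (p t) = P t) ∧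
          ∀ V ∈ Uad, 0 ≤ (∫ t in Ioo 0 T,
            inner ℂ (V t - U t) (controlAdjoint R (p t) + (ν : ℂ) • U t)).re := by
  have hJ0 : 0 < J := by lia
  have hτ : 0 < T / J := step_pos hT hJ0
  have hb0 : 0 < convCoeff (1 - α) (T / J) 0 := convCoeff_zero_pos (by linarith) hτ
  have hbneg : ∀ n < 0, convCoeff (1 - α) (T / J) n = 0 := fun n hn => convCoeff_neg hn
  have hω : 0 < ω₀ := by linarith [hA.angle_gt, Real.pi_pos]
  have hbij := bijective_of_resolvSet hι hω hA.resolv hb0 hτ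
  have hbij' := bijective_of_resolvSet hι hω hA.resolv_star hb0 hτ
  obtain ⟨S, hS⟩ := exists_convSol hbij' hbneg J
  obtain ⟨S', hS'⟩ := exists_convSol hbij hbneg J
  obtain ⟨R', hR'⟩ := hR.exists_clm hθ0.le hθ1
  obtain rfl : (R' : Z →ₗ[ℂ] (X →L⋆[ℂ] ℂ)) = R := LinearMap.ext hR'
  have hstate : ∀ g : ℝ → (X →L⋆[ℂ] ℂ), IntegrableOn g (Ioo 0 T) →
      IsDiscreteState ι Astar α T J g (discreteState ι Astar α T J g) ∧
      ∀ W, IsDiscreteState ι Astar α T J g W →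
        HasSteps T J W (fun k => S k (gridData T J g)) := by
    intro g hg
    exact discreteState_spec hT hJ0 hα1 hS hg
  have hadj : ∀ g : ℝ → (X →L⋆[ℂ] ℂ), IntegrableOn g (Ioo 0 T) →
      IsDiscreteAdjoint ι A α T J g (discreteAdjoint ι A α T J g) ∧
      ∀ W, IsDiscreteAdjoint ι A α T J g W → HasSteps T J W
        (fun k => S' (J - 1 - k) (fun i => gridData T J g (J - 1 - i))) := by
    intro g hg
    exact discreteAdjoint_spec hT hJ0 hα1 hS' hg
  refine ⟨fun g hg => ⟨(hstate g hg).1, fun W hW => ?_⟩,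
    fun g hg => ⟨(hadj g hg).1, fun W hW => ?_⟩, integrableOn_applyControl R',
    controlAdjoint_spec R', ?_⟩
  · exact ((hstate g hg).2 W hW).ae_eq hT hJ0 ((hstate g hg).2 _ (hstate g hg).1) fun _ _ => rfl
  · exact ((hadj g hg).2 W hW).ae_eq hT hJ0 ((hadj g hg).2 _ (hadj g hg).1) fun _ _ => rfl
  -- The control-to-observation operator is linear and bounded.
  obtain ⟨L, hL⟩ : ∃ L : L2 T Z →L[ℂ] Y, ∀ u : L2 T Z,
      L u = S (J - 1) (gridData T J (applyControl (R' : Z →ₗ[ℂ] (X →L⋆[ℂ] ℂ)) u)) := by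
    choose! Q hQ using fun k (hk : k < J) => exists_gridData_clm hT hJ0 R' hk
    refine ⟨(S (J - 1)).comp (ContinuousLinearMap.pi Q), fun u => ?_⟩
    -- Only the data on the grid intervals inside `(0, T)` matter.
    exact ((hS _).2 _ (fun k hk => ((hS _).1 k hk).trans (hQ k hk u)) (J - 1) (by lia))
  have hlast : ∀ u : L2 T Z, Function.leftLim (discreteState ι Astar α T J
      (applyControl (R' : Z →ₗ[ℂ] (X →L⋆[ℂ] ℂ)) u)) T = L u := by
    intro u
    have h := hstate _ (integrableOn_applyControl R' u)
    rw [hL, (h.2 _ h.1).leftLim_last hT hJ0]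
  have hcost : ∀ u : L2 T Z, discreteCost ι Astar (R' : Z →ₗ[ℂ] (X →L⋆[ℂ] ℂ)) α T J yd ν u
      = 1 / 2 * ‖L u - yd‖ ^ 2 + ν / 2 * ‖u‖ ^ 2 := fun u => by rw [discreteCost, hlast]
  obtain ⟨U, hU, hVI⟩ := exists_variational_inequality L yd hν hUne hUconv hUclosed
  -- The cost exceeds its minimum by at least `ν / 2 * ‖V - U‖ ^ 2`.
  have hgrowth : ∀ V ∈ Uad, discreteCost ι Astar (R' : Z →ₗ[ℂ] (X →L⋆[ℂ] ℂ)) α T J yd ν U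
      + ν / 2 * ‖V - U‖ ^ 2
        ≤ discreteCost ι Astar (R' : Z →ₗ[ℂ] (X →L⋆[ℂ] ℂ)) α T J yd ν V := by
    intro V hV
    rw [hcost, hcost, tracking_expand L yd ν U V]
    have h1 := hVI V hV
    have h2 := sq_nonneg ‖L (V - U)‖
    linarith
  refine ⟨U, hU, fun V hV => ?_, fun U' hU' hmin => ?_, _, _, rfl, rfl, ?_⟩
  · have h1 := hgrowth V hV
    have h2 : 0 ≤ ν / 2 * ‖V - U‖ ^ 2 := by positivity
    linarith
  · have h1 := hgrowth U' hU'
    have h2 := hmin U hU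
    have h3 : ν / 2 * ‖U' - U‖ ^ 2 ≤ 0 := by linarith
    have h4 : ‖U' - U‖ ^ 2 ≤ 0 := nonpos_of_mul_nonpos_right h3 (by positivity)
    have h5 : ‖U' - U‖ = 0 := pow_eq_zero_iff (two_ne_zero) |>.mp (le_antisymm h4 (sq_nonneg _))
    exact sub_eq_zero.mp (norm_eq_zero.mp h5)
  -- From here on `y = Y(T-) - y_d`, and the adjoint solution `P` is the reversal of the sequence
  -- solving the system with data `y` in the first step and zero afterwards.
  rw [hlast]
  set y := L U - yd
  set gs : ℝ → (X →L⋆[ℂ] ℂ) := fun t => transp ι (deltaHat T J t • y)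
  have hgsint : IntegrableOn gs (Ioo 0 T) :=
    ((hasSteps_deltaHat hT hJ0).comp fun c => transp ι (c • y)).integrableOn hT hJ0
  have hPsteps := (hadj gs hgsint).2 _ (hadj gs hgsint).1
  have hconv : IsConvSol ι A (convCoeff (1 - α) (T / J)) (T / J) J
      (fun k => transp ι (if k = 0 then y else 0))
      (fun k => S' k fun i => gridData T J gs (J - 1 - i)) := by
    intro k hk
    refine ((hS' fun i => gridData T J gs (J - 1 - i)).1 k hk).trans
      ((gridData_deltaHat hT hJ0 ι y (show J - 1 - k < J by lia)).trans ?_)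
    have : J - 1 - k = J - 1 ↔ k = 0 := by lia
    simp only [this]
  obtain ⟨p, hp⟩ := hconv.exists_lift hιd hA.adjoint hbij hbij' hbneg
  have hpsteps := hasSteps_stepFun hT hJ0 fun k => p (J - 1 - k)
  refine ⟨_, (mem_Wstep_iff hT hJ0).mpr ⟨_, hpsteps⟩, ?_, fun V hV => ?_⟩
  · exact (hpsteps.comp ι).ae_eq hT hJ0 hPsteps fun k hk => (hp (J - 1 - k) (by lia)).1
  have hgint := integrableOn_applyControl R' (V - U)
  set pf := stepFun T J fun k => p (J - 1 - k)
  -- `⟨R (V - U), P⟩` integrates to the derivative of the tracking term.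
  have hdual : ∫ t in Ioo 0 T,
      applyControl (R' : Z →ₗ[ℂ] (X →L⋆[ℂ] ℂ)) (V - U) t (pf t) = inner ℂ y (L (V - U)) := by
    rw [hpsteps.integral_pairing hT hJ0 hgint, (hS _).1.sum_duality (p := p)
      (y := fun k => if k = 0 then y else 0) fun k hk => ?_, hL,
      Finset.sum_eq_single_of_mem (J - 1) (Finset.mem_range.mpr (by lia))]
    · simp
    · intro k hk hne
      have := Finset.mem_range.mp hk
      rw [if_neg (by lia), inner_zero_left]
    · refine Eq.trans ?_ (hp k hk).2
      congr 1
      exact Finset.sum_congr rfl fun i hi => by rw [(hp i (Finset.mem_range.mp hi)).1]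
  have hint1 : Integrable (fun t => starRingEnd ℂ
      (applyControl (R' : Z →ₗ[ℂ] (X →L⋆[ℂ] ℂ)) (V - U) t (pf t)))
      (volume.restrict (Ioo 0 T)) :=
    Complex.conjCLE.toContinuousLinearMap.integrable_comp
      (hpsteps.integrableOn_pairing hT hJ0 hgint)
  have hint2 : Integrable (fun t => (ν : ℂ) * inner ℂ ((V - U : L2 T Z) t) (U t))
      (volume.restrict (Ioo 0 T)) := (L2.integrable_inner (V - U) U).const_mul _
  have heq : ∫ t in Ioo 0 T,
      inner ℂ (V t - U t) (controlAdjoint (R' : Z →ₗ[ℂ] (X →L⋆[ℂ] ℂ)) (pf t) + (ν : ℂ) • U t)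
        = inner ℂ (L (V - U)) y + (ν : ℂ) * inner ℂ (V - U) U := by
    rw [← inner_conj_symm (L (V - U)) y, ← hdual, L2.inner_def, ← integral_const_mul,
      ← integral_conj, ← integral_add hint1 hint2]
    refine integral_congr_ae ?_
    filter_upwards [Lp.coeFn_sub V U] with t ht
    rw [inner_add_right, controlAdjoint_spec, inner_smul_right, applyControl, ht]
    rfl
  rw [heq]
  exact hVI V hV
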